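/- **Conventions.** Idempotent semirings are commutative and written with the max-plus operations $(\vee,-\infty,+,0)$; they carry the order $X\le Y\iff X\vee Y=Y$ and are assumed to satisfy the Tate condition: every element is bounded above by an invertible one. An element is *bounded* if it lies between two invertible elements, and $\mathrm{PL}(\alpha)$ denotes the localisation of $\alpha$ that adjoins additive inverses to all bounded elements. An *order ideal* is a non-empty lower set closed under $\vee$. An inclusion $\iota\subseteq\kappa$ of order ideals of $\alpha$ is *integral* if for every $X\in\kappa$ there are a bounded $S$ and a $Y\in\iota$ with $X+S\le Y+S$. An order ideal is *integrally closed* if it contains every order ideal integral over it; an *integral closure* of $\iota$ is an integrally closed ideal integral over $\iota$. An element is integrally closed if the order ideal it generates is, and $\alpha$ is *normal* if all its elements are integrally closed. A homomorphism $f:\alpha\to\beta$ is a *normalisation* if $\beta$ is normal, every homomorphism from $\alpha$ to a normal semiring factors uniquely through $f$, and $f$ identifies $\beta$ with the image of $\alpha$ in $\mathrm{PL}(\alpha)$. **Theorem.** Let $N$ be a finite-dimensional real affine space whose space of translations $V$ carries a full-rank lattice $\Lambda$. Let $Q$ be the group of affine functions $N\to\mathbb R$ with integer slopes (i.e. whose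 linear part is integer-valued on $\Lambda$; the constants are arbitrary reals), let $\Delta\subseteq N$ be a bounded rational polytope, i.e. a bounded set of the form $\{x: F_1(x)\le 0,\dots,F_k(x)\le 0\}$ with $F_i\in Q$, and let $Q^+\subseteq Q$ be the submonoid of functions that are $\le 0$ on $\Delta$. Let $\mathbb B[Q;Q^+]$ be the semiring of finitely generated $Q^+$-invariant subsets of $Q$, with union as $\vee$, $\emptyset$ as $-\infty$, Minkowski sum as $+$ and $Q^+$ as $0$. Let $\mathrm{CPA}_{\mathbb Z}(\Delta,\mathbb R)$ be the semiring of convex functions $\Delta\to\mathbb R$ that are piecewise-affine with integer slopes (i.e. $\Delta$ is covered by finitely many polyhedra on each of which the function agrees with an element of $Q$), together with an element $-\infty$, under pointwise maximum and sum. Then the evaluation map $$\mathrm{ev}:\mathbb B[Q;Q^+]\to\mathrm{CPA}_{\mathbb Z}(\Delta,\mathbb R),\qquad \mathrm{ev}(I)(x)=\sup_{F\in I}F(x),\quad \mathrm{ev}(\emptyset)=-\infty,$$ is a normalisation of idempotent semirings. Consequently integrally closed elements are canonical maximal representatives of functions: for every $X\in\mathbb B[Q;Q^+]$ the set $\{Y:\mathrm{ev}(Y)\le\mathrm{ev}(X)\}$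 is an integral closure of the order ideal generated by $X$, and $X$ is integrally closed if and only if it is the greatest element of $\{Y:\mathrm{ev}(Y)=\mathrm{ev}(X)\}$. -/

import Mathlib

open scoped Pointwise

universe u v w

/-! Convention: in an idempotent semiring the max-plus operations `∨`, `-∞`, `+`, `0` are written
`+` (which is `⊔`), `0` (which is `⊥`), `*`, `1`. -/

namespace IdempotentSemiring

section General

variable {α : Type*} [IdemCommSemiring α]

/-- Tate condition: every element is bounded above by an invertible element. -/
class Tate (α : Type*) [IdemCommSemiring α] : Prop where
  exists_le_unit : ∀ x : α, ∃ u : αˣ, x ≤ (u : α)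

/-- An element is bounded if it lies between two invertible elements. -/
def Bounded (x : α) : Prop := ∃ u v : αˣ, (u : α) ≤ x ∧ x ≤ (v : α)

theorem mul_le_mul_of_le {a b c d : α} (h₁ : a ≤ b) (h₂ : c ≤ d) : a * c ≤ b * d := by
  rw [← sup_eq_right, ← add_eq_sup] at h₁ h₂ ⊢
  calc a * c + b * d = a * c + (a + b) * (c + d) := by rw [h₁, h₂]
    _ = (a * c + a * c) + a * d + b * c + b * d := by ring
    _ = a * c + a * d + b * c + b * d := by rw [add_idem]
    _ = (a + b) * (c + d) := by ring
    _ = b * d := by rw [h₁, h₂]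

/-- The multiplicative submonoid of bounded elements. -/
def boundedSubmonoid (α : Type*) [IdemCommSemiring α] : Submonoid α where
  carrier := {x | Bounded x}
  one_mem' := ⟨1, 1, by simp, by simp⟩
  mul_mem' := by
    rintro a b ⟨u, v, h₁, h₂⟩ ⟨u', v', h₃, h₄⟩
    refine ⟨u * u', v * v', ?_, ?_⟩
    · rw [Units.val_mul]; exact mul_le_mul_of_le h₁ h₃
    · rw [Units.val_mul]; exact mul_le_mul_of_le h₂ h₄

/-- The bounded difference semiring `PL(α)`: the localisation at all bounded elements. -/
abbrev PL (α : Type*) [IdemCommSemiring α] : Type _ := Localization (boundedSubmonoid α)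

/-- The image of `α` in its bounded difference semiring. -/
abbrev imagePL (α : Type*) [IdemCommSemiring α] : Subsemiring (PL α) :=
  (algebraMap α (PL α)).rangeS

/-- `κ` is integral over `ι`: for each `X ∈ κ` there is a bounded `S` such that `X + S` lies in the
order ideal generated by `ι + S`. -/
def IsIntegralOver (κ ι : Order.Ideal α) : Prop :=
  ι ≤ κ ∧ ∀ X ∈ κ, ∃ S : α, Bounded S ∧ ∃ Y ∈ ι, X * S ≤ Y * S

/-- An order ideal is integrally closed if it contains every ideal integral over it. -/
def IsIntegrallyClosed (ι : Order.Ideal α) : Prop :=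
  ∀ κ : Order.Ideal α, IsIntegralOver κ ι → κ ≤ ι

/-- `κ` is an integral closure of `ι`. -/
def IsIntegralClosure (κ ι : Order.Ideal α) : Prop :=
  IsIntegrallyClosed κ ∧ IsIntegralOver κ ι

/-- An element is integrally closed if the order ideal it generates is. -/
def IsIntegrallyClosedElement (X : α) : Prop := IsIntegrallyClosed (Order.Ideal.principal X)

/-- A semiring is normal if every element is integrally closed. -/
def IsNormal (α : Type*) [IdemCommSemiring α] : Prop := ∀ X : α, IsIntegrallyClosedElement X

end General

/-- `f : α → β` is a normalisation: `β` is normal, `f` is initial among homomorphisms from `α` to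
normal semirings, and `f` identifies `β` with the image of `α` in `PL(α)`. -/
structure IsNormalisation {α : Type u} {β : Type v} [IdemCommSemiring α] [Tate α]
    [IdemCommSemiring β] [Tate β] (f : α →+* β) : Prop where
  isNormal : IsNormal β
  initial : ∀ (γ : Type w) [IdemCommSemiring γ] [Tate γ], IsNormal γ →
    ∀ g : α →+* γ, ∃! h : β →+* γ, h.comp f = g
  equiv_imagePL : ∃ e : imagePL α ≃+* β,
    ∀ X : α, e ((algebraMap α (PL α)).rangeSRestrict X) = f X

/-- A fractional ideal of the pair `(M; P)`: a finitely generated `P`-invariant subset of `M`. -/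
@[ext] structure FracIdeal {M : Type*} [AddCommMonoid M] (P : AddSubmonoid M) where
  carrier : Set M
  add_mem : ∀ x ∈ carrier, ∀ p ∈ P, x + p ∈ carrier
  fg : ∃ G : Set M, G.Finite ∧ carrier = G + (P : Set M)

namespace FracIdeal

variable {M : Type*} [AddCommMonoid M] {P : AddSubmonoid M}

theorem add_coe_self (P : AddSubmonoid M) : (P : Set M) + (P : Set M) = P := by
  simp

theorem carrier_add (I : FracIdeal P) : I.carrier + (P : Set M) = I.carrier := by
  obtain ⟨G, -, h⟩ := I.fg
  rw [h, add_assoc, add_coe_self]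

/-- The fractional ideal generated by a finite set. -/
def span (P : AddSubmonoid M) (G : Set M) (hG : G.Finite) : FracIdeal P where
  carrier := G + (P : Set M)
  add_mem := by
    rintro _ ⟨g, hg, q, hq, rfl⟩ p hp
    exact ⟨g, hg, q + p, P.add_mem hq hp, (add_assoc g q p).symm⟩
  fg := ⟨G, hG, rfl⟩

/-- The principal fractional ideal `x + P`. -/
def principal (P : AddSubmonoid M) (x : M) : FracIdeal P := span P {x} (Set.finite_singleton x)

/-- The join of two fractional ideals is their union. -/
instance : Add (FracIdeal P) where
  add I J := ⟨I.carrier ∪ J.carrier,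
    fun x hx p hp => hx.imp (fun h => I.add_mem x h p hp) (fun h => J.add_mem x h p hp), by
      obtain ⟨G, hG, h⟩ := I.fg
      obtain ⟨G', hG', h'⟩ := J.fg
      exact ⟨G ∪ G', hG.union hG', by rw [h, h', Set.union_add]⟩⟩

/-- The element `-∞` is the empty fractional ideal. -/
instance : Zero (FracIdeal P) := ⟨⟨∅, by simp, ⟨∅, by simp, by simp⟩⟩⟩

/-- The semiring addition of max-plus algebra is the Minkowski sum. -/
instance : Mul (FracIdeal P) where
  mul I J := ⟨I.carrier + J.carrier, by
      rintro _ ⟨a, ha, b, hb, rfl⟩ p hp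
      exact ⟨a, ha, b + p, J.add_mem b hb p hp, (add_assoc a b p).symm⟩, by
      obtain ⟨G, hG, h⟩ := I.fg
      obtain ⟨G', hG', h'⟩ := J.fg
      refine ⟨G + G', hG.add hG', ?_⟩
      rw [h, h', add_add_add_comm, add_coe_self]⟩

/-- The neutral element for the Minkowski sum is `P`. -/
instance : One (FracIdeal P) :=
  ⟨⟨P, fun _ hx p hp => P.add_mem hx hp, ⟨{0}, by simp, by simp⟩⟩⟩

/-- The free semiring `B[M; P]` of fractional ideals; the order is inclusion. -/
instance : IdemCommSemiring (FracIdeal P) where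
  nsmul := nsmulRec
  add_assoc I J K := FracIdeal.ext (Set.union_assoc _ _ _)
  zero_add I := FracIdeal.ext (Set.empty_union _)
  add_zero I := FracIdeal.ext (Set.union_empty _)
  add_comm I J := FracIdeal.ext (Set.union_comm _ _)
  left_distrib I J K := FracIdeal.ext Set.add_union
  right_distrib I J K := FracIdeal.ext Set.union_add
  zero_mul I := FracIdeal.ext Set.empty_add
  mul_zero I := FracIdeal.ext Set.add_empty
  mul_assoc I J K := FracIdeal.ext (add_assoc _ _ _)
  one_mul I := FracIdeal.ext ((add_comm _ _).trans I.carrier_add)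
  mul_one I := FracIdeal.ext I.carrier_add
  mul_comm I J := FracIdeal.ext (add_comm _ _)
  le I J := I.carrier ⊆ J.carrier
  le_refl I := subset_rfl
  le_trans I J K h h' := h.trans h'
  le_antisymm I J h h' := FracIdeal.ext (h.antisymm h')
  sup I J := I + J
  le_sup_left I J := Set.subset_union_left
  le_sup_right I J := Set.subset_union_right
  sup_le I J K := Set.union_subset
  bot := 0
  bot_le I := Set.empty_subset _
  add_eq_sup I J := rfl

theorem carrier_add_eq (I J : FracIdeal P) : (I + J).carrier = I.carrier ∪ J.carrier := rfl
theorem carrier_mul_eq (I J : FracIdeal P) : (I * J).carrier = I.carrier + J.carrier := rfl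
theorem carrier_zero : (0 : FracIdeal P).carrier = ∅ := rfl
theorem carrier_one : (1 : FracIdeal P).carrier = (P : Set M) := rfl
theorem le_def {I J : FracIdeal P} : I ≤ J ↔ I.carrier ⊆ J.carrier := Iff.rfl

theorem mem_principal {x y : M} : y ∈ (principal P x).carrier ↔ ∃ p ∈ P, x + p = y := by
  simp [principal, span]

theorem principal_mul_principal (x y : M) :
    principal P x * principal P y = principal P (x + y) := by
  apply FracIdeal.ext
  change (({x} : Set M) + (P : Set M)) + ({y} + (P : Set M)) = {x + y} + (P : Set M)
  rw [add_add_add_comm, add_coe_self, Set.singleton_add_singleton]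

theorem principal_zero : principal P (0 : M) = 1 := by
  apply FracIdeal.ext
  change ({0} : Set M) + (P : Set M) = P
  simp

end FracIdeal

section Polytope

variable {V N : Type*} [NormedAddCommGroup V] [NormedSpace ℝ V] [MetricSpace N]
  [NormedAddTorsor V N]

/-- The group `Q` of affine functions on `N` with integer slopes, i.e. whose linear part takes
integer values on the lattice `Λ`; the constants are arbitrary reals. -/
def intAffine (N : Type*) [MetricSpace N] [NormedAddTorsor V N] (Λ : Submodule ℤ V) :
    AddSubgroup (N →ᵃ[ℝ] ℝ) where
  carrier := {F | ∀ v ∈ Λ, ∃ m : ℤ, F.linear v = m}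
  zero_mem' := fun v _ => ⟨0, by simp⟩
  add_mem' := by
    intro F G hF hG v hv
    obtain ⟨a, ha⟩ := hF v hv
    obtain ⟨b, hb⟩ := hG v hv
    exact ⟨a + b, by simp [ha, hb]⟩
  neg_mem' := by
    intro F hF v hv
    obtain ⟨a, ha⟩ := hF v hv
    exact ⟨-a, by simp [ha]⟩

/-- A constant, as an element of `Q`. -/
def intAffineConst (N : Type*) [MetricSpace N] [NormedAddTorsor V N] (Λ : Submodule ℤ V) (c : ℝ) :
    intAffine N Λ := ⟨AffineMap.const ℝ N c, fun v _ => ⟨0, by simp⟩⟩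

/-- A bounded rational polytope: a bounded set cut out by finitely many affine inequalities with
integer slopes. -/
structure RatPolytope (N : Type*) [MetricSpace N] [NormedAddTorsor V N] (Λ : Submodule ℤ V) where
  carrier : Set N
  isBounded : Bornology.IsBounded carrier
  cut_out : ∃ s : Set (N →ᵃ[ℝ] ℝ), s.Finite ∧ (∀ F ∈ s, F ∈ intAffine N Λ) ∧
    carrier = {x | ∀ F ∈ s, F x ≤ 0}

/-- A (closed, possibly unbounded) polyhedron in `N`. -/
def IsPolyhedron (A : Set N) : Prop :=
  ∃ s : Set (N →ᵃ[ℝ] ℝ), s.Finite ∧ A = {x | ∀ g ∈ s, g x ≤ 0}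

theorem IsPolyhedron.inter {A B : Set N} (hA : IsPolyhedron A) (hB : IsPolyhedron B) :
    IsPolyhedron (A ∩ B) := by
  obtain ⟨s, hs, rfl⟩ := hA
  obtain ⟨t, ht, rfl⟩ := hB
  refine ⟨s ∪ t, hs.union ht, ?_⟩
  ext x
  simp only [Set.mem_inter_iff, Set.mem_ofPred_eq, Set.mem_union]
  constructor
  · rintro ⟨h, h'⟩ g (hg | hg)
    exacts [h g hg, h' g hg]
  · exact fun h => ⟨fun g hg => h g (Or.inl hg), fun g hg => h g (Or.inr hg)⟩

theorem isPolyhedron_le (F G : N →ᵃ[ℝ] ℝ) : IsPolyhedron {x | F x ≤ G x} :=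
  ⟨{F - G}, Set.finite_singleton _, by ext x; simp⟩

variable {Λ : Submodule ℤ V} (Δ : RatPolytope N Λ)

/-- The submonoid `Q⁺ ⊆ Q` of functions that are `≤ 0` on `Δ`. -/
def RatPolytope.nonpos : AddSubmonoid (intAffine N Λ) where
  carrier := {F | ∀ x ∈ Δ.carrier, (F : N →ᵃ[ℝ] ℝ) x ≤ 0}
  zero_mem' := fun x _ => by simp
  add_mem' := by
    intro F G hF hG x hx
    simpa using add_nonpos (hF x hx) (hG x hx)

/-- The semiring `B[Q; Q⁺]` of the polytope. -/
abbrev RatPolytope.B : Type _ := FracIdeal Δ.nonpos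

/-- A real function on `Δ` is convex. -/
def IsConvexFun (f : Δ.carrier → ℝ) : Prop :=
  ∀ (x y z : Δ.carrier) (t : ℝ), 0 ≤ t → t ≤ 1 → (z : N) = AffineMap.lineMap (x : N) (y : N) t →
    f z ≤ (1 - t) * f x + t * f y

/-- A real function on `Δ` is piecewise-affine with integer slopes: `Δ` is covered by finitely many
polyhedra, on each of which the function agrees with an affine function of integer slopes. -/
def IsPiecewiseIntAffine (f : Δ.carrier → ℝ) : Prop :=
  ∃ C : Set (Set N × intAffine N Λ), C.Finite ∧ (∀ p ∈ C, IsPolyhedron p.1) ∧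
    (∀ x : Δ.carrier, ∃ p ∈ C, (x : N) ∈ p.1) ∧
    ∀ p ∈ C, ∀ x : Δ.carrier, (x : N) ∈ p.1 → f x = (p.2 : N →ᵃ[ℝ] ℝ) x

/-- The real-valued convex piecewise-affine functions on `Δ` with integer slopes. -/
def CPAFun : Type _ := {f : Δ.carrier → ℝ // IsConvexFun Δ f ∧ IsPiecewiseIntAffine Δ f}

variable {Δ}

theorem IsPiecewiseIntAffine.add {f g : Δ.carrier → ℝ} (hf : IsPiecewiseIntAffine Δ f)
    (hg : IsPiecewiseIntAffine Δ g) : IsPiecewiseIntAffine Δ (f + g) := by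
  obtain ⟨A, hA, hA₁, hA₂, hA₃⟩ := hf
  obtain ⟨B, hB, hB₁, hB₂, hB₃⟩ := hg
  refine ⟨Set.image2 (fun p q => (p.1 ∩ q.1, p.2 + q.2)) A B, hA.image2 _ hB, ?_, ?_, ?_⟩
  · rintro _ ⟨p, hp, q, hq, rfl⟩
    exact (hA₁ p hp).inter (hB₁ q hq)
  · intro x
    obtain ⟨p, hp, hxp⟩ := hA₂ x
    obtain ⟨q, hq, hxq⟩ := hB₂ x
    exact ⟨_, ⟨p, hp, q, hq, rfl⟩, hxp, hxq⟩
  · rintro _ ⟨p, hp, q, hq, rfl⟩ x ⟨hxp, hxq⟩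
    simp [hA₃ p hp x hxp, hB₃ q hq x hxq]

theorem IsPiecewiseIntAffine.sup {f g : Δ.carrier → ℝ} (hf : IsPiecewiseIntAffine Δ f)
    (hg : IsPiecewiseIntAffine Δ g) : IsPiecewiseIntAffine Δ (f ⊔ g) := by
  obtain ⟨A, hA, hA₁, hA₂, hA₃⟩ := hf
  obtain ⟨B, hB, hB₁, hB₂, hB₃⟩ := hg
  refine ⟨Set.image2 (fun p q => (p.1 ∩ q.1 ∩
      {x | (q.2 : N →ᵃ[ℝ] ℝ) x ≤ (p.2 : N →ᵃ[ℝ] ℝ) x}, p.2)) A B ∪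
    Set.image2 (fun p q => (p.1 ∩ q.1 ∩
      {x | (p.2 : N →ᵃ[ℝ] ℝ) x ≤ (q.2 : N →ᵃ[ℝ] ℝ) x}, q.2)) A B,
    (hA.image2 _ hB).union (hA.image2 _ hB), ?_, ?_, ?_⟩
  · rintro _ (⟨p, hp, q, hq, rfl⟩ | ⟨p, hp, q, hq, rfl⟩)
    · exact ((hA₁ p hp).inter (hB₁ q hq)).inter (isPolyhedron_le _ _)
    · exact ((hA₁ p hp).inter (hB₁ q hq)).inter (isPolyhedron_le _ _)
  · intro x
    obtain ⟨p, hp, hxp⟩ := hA₂ x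
    obtain ⟨q, hq, hxq⟩ := hB₂ x
    rcases le_total ((q.2 : N →ᵃ[ℝ] ℝ) x) ((p.2 : N →ᵃ[ℝ] ℝ) x) with h | h
    · exact ⟨_, Or.inl ⟨p, hp, q, hq, rfl⟩, ⟨hxp, hxq⟩, h⟩
    · exact ⟨_, Or.inr ⟨p, hp, q, hq, rfl⟩, ⟨hxp, hxq⟩, h⟩
  · rintro _ (⟨p, hp, q, hq, rfl⟩ | ⟨p, hp, q, hq, rfl⟩) x ⟨⟨hxp, hxq⟩, h⟩
    · have h' : (q.2 : N →ᵃ[ℝ] ℝ) x ≤ (p.2 : N →ᵃ[ℝ] ℝ) x := h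
      simp only [Pi.sup_apply, hA₃ p hp x hxp, hB₃ q hq x hxq]
      exact max_eq_left h'
    · have h' : (p.2 : N →ᵃ[ℝ] ℝ) x ≤ (q.2 : N →ᵃ[ℝ] ℝ) x := h
      simp only [Pi.sup_apply, hA₃ p hp x hxp, hB₃ q hq x hxq]
      exact max_eq_right h'

theorem IsConvexFun.add {f g : Δ.carrier → ℝ} (hf : IsConvexFun Δ f) (hg : IsConvexFun Δ g) :
    IsConvexFun Δ (f + g) := by
  intro x y z t h0 h1 hz
  have := hf x y z t h0 h1 hz
  have := hg x y z t h0 h1 hz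
  simp only [Pi.add_apply]
  linarith

theorem IsConvexFun.sup {f g : Δ.carrier → ℝ} (hf : IsConvexFun Δ f) (hg : IsConvexFun Δ g) :
    IsConvexFun Δ (f ⊔ g) := by
  intro x y z t h0 h1 hz
  have h1' : 0 ≤ 1 - t := by linarith
  refine sup_le ((hf x y z t h0 h1 hz).trans ?_) ((hg x y z t h0 h1 hz).trans ?_)
  · exact add_le_add (mul_le_mul_of_nonneg_left le_sup_left h1')
      (mul_le_mul_of_nonneg_left le_sup_left h0)
  · exact add_le_add (mul_le_mul_of_nonneg_left le_sup_right h1')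
      (mul_le_mul_of_nonneg_left le_sup_right h0)

theorem isConvexFun_affine (F : N →ᵃ[ℝ] ℝ) : IsConvexFun Δ (fun x => F x) := by
  intro x y z t _ _ hz
  simp only [hz, AffineMap.apply_lineMap]
  rw [AffineMap.lineMap_apply]
  simp only [vsub_eq_sub, smul_eq_mul, vadd_eq_add]
  apply le_of_eq
  ring

theorem isPiecewiseIntAffine_affine (F : intAffine N Λ) :
    IsPiecewiseIntAffine Δ (fun x => (F : N →ᵃ[ℝ] ℝ) x) :=
  ⟨{(Set.univ, F)}, Set.finite_singleton _,
    by rintro _ rfl; exact ⟨∅, Set.finite_empty, by simp⟩,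
    fun x => ⟨_, rfl, Set.mem_univ _⟩, by rintro _ rfl x _; rfl⟩

namespace CPAFun

/-- The restriction to `Δ` of an affine function of integer slopes. -/
def ofAffine (F : intAffine N Λ) : CPAFun Δ :=
  ⟨fun x => (F : N →ᵃ[ℝ] ℝ) x, isConvexFun_affine _, isPiecewiseIntAffine_affine F⟩

instance : SemilatticeSup (CPAFun Δ) :=
  Subtype.semilatticeSup (fun _ _ hf hg => ⟨hf.1.sup hg.1, hf.2.sup hg.2⟩)

instance : Add (CPAFun Δ) := ⟨fun f g => ⟨f.1 + g.1, f.2.1.add g.2.1, f.2.2.add g.2.2⟩⟩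

instance : Zero (CPAFun Δ) := ⟨ofAffine 0⟩

instance : AddCommMonoid (CPAFun Δ) where
  nsmul := nsmulRec
  add_assoc f g h := Subtype.ext (add_assoc _ _ _)
  add_comm f g := Subtype.ext (add_comm _ _)
  zero_add f := Subtype.ext (zero_add f.1)
  add_zero f := Subtype.ext (add_zero f.1)

theorem add_val (f g : CPAFun Δ) : (f + g).1 = f.1 + g.1 := rfl
theorem sup_val (f g : CPAFun Δ) : (f ⊔ g).1 = f.1 ⊔ g.1 := rfl
theorem zero_val : (0 : CPAFun Δ).1 = 0 := rfl

theorem add_sup' (f g h : CPAFun Δ) : f + (g ⊔ h) = (f + g) ⊔ (f + h) := by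
  apply Subtype.ext
  funext x
  exact add_max (f.1 x) (g.1 x) (h.1 x)

end CPAFun

variable (Δ) in
/-- The semiring `CPA_ℤ(Δ, ℝ)`: the convex piecewise-affine functions of integer slopes on `Δ`,
with an element `-∞` adjoined. -/
def CPA : Type _ := WithBot (CPAFun Δ)

namespace CPA

/-- A real-valued function as an element of `CPA_ℤ(Δ, ℝ)`. -/
def ofFun (f : CPAFun Δ) : CPA Δ := (f : WithBot (CPAFun Δ))

theorem mul_sup' (a b c : WithBot (CPAFun Δ)) : a + (b ⊔ c) = (a + b) ⊔ (a + c) := by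
  induction a with
  | bot => simp
  | coe a =>
    induction b with
    | bot => simp
    | coe b =>
      induction c with
      | bot => simp
      | coe c =>
        rw [← WithBot.coe_sup, ← WithBot.coe_add, ← WithBot.coe_add, ← WithBot.coe_add,
          ← WithBot.coe_sup, CPAFun.add_sup']

/-- The join is the pointwise maximum. -/
instance : Add (CPA Δ) := ⟨fun a b => max (α := WithBot (CPAFun Δ)) a b⟩

/-- The element `-∞`. -/
instance : Zero (CPA Δ) := ⟨(⊥ : WithBot (CPAFun Δ))⟩

/-- The semiring addition of max-plus algebra is the pointwise sum. -/
instance : Mul (CPA Δ) := ⟨Add.add (α := WithBot (CPAFun Δ))⟩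

/-- The constant function with value `0`. -/
instance : One (CPA Δ) := ⟨(0 : WithBot (CPAFun Δ))⟩

/-- The semiring structure; the order is the pointwise one. -/
instance : IdemCommSemiring (CPA Δ) where
  __ := (inferInstance : SemilatticeSup (WithBot (CPAFun Δ)))
  __ := (inferInstance : OrderBot (WithBot (CPAFun Δ)))
  nsmul := nsmulRec
  add_assoc := sup_assoc (α := WithBot (CPAFun Δ))
  zero_add := bot_sup_eq (α := WithBot (CPAFun Δ))
  add_zero := sup_bot_eq (α := WithBot (CPAFun Δ))
  add_comm := sup_comm (α := WithBot (CPAFun Δ))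
  left_distrib := mul_sup'
  right_distrib a b c := by
    refine (add_comm (G := WithBot (CPAFun Δ)) _ _).trans ((mul_sup' c a b).trans ?_)
    exact congrArg₂ (α := WithBot (CPAFun Δ)) (· ⊔ ·) (add_comm _ _) (add_comm _ _)
  zero_mul := WithBot.bot_add
  mul_zero := WithBot.add_bot
  mul_assoc := add_assoc (G := WithBot (CPAFun Δ))
  one_mul := zero_add (M := WithBot (CPAFun Δ))
  mul_one := add_zero (M := WithBot (CPAFun Δ))
  mul_comm := add_comm (G := WithBot (CPAFun Δ))
  add_eq_sup a b := rfl

theorem ofFun_mul (f g : CPAFun Δ) : ofFun f * ofFun g = ofFun (f + g) := rfl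
theorem ofFun_add (f g : CPAFun Δ) : ofFun f + ofFun g = ofFun (f ⊔ g) := rfl
theorem one_eq : (1 : CPA Δ) = ofFun 0 := rfl
theorem ofFun_le {f g : CPAFun Δ} : ofFun f ≤ ofFun g ↔ f ≤ g := WithBot.coe_le_coe

end CPA

/-- The pointwise supremum of the affine functions in a fractional ideal. -/
noncomputable def evFun (I : Δ.B) (x : Δ.carrier) : ℝ :=
  sSup ((fun F : intAffine N Λ => (F : N →ᵃ[ℝ] ℝ) x) '' I.carrier)

theorem exists_generator_isGreatest {I : Δ.B} {G : Set (intAffine N Λ)} (hG : G.Finite)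
    (hI : I.carrier = G + (Δ.nonpos : Set (intAffine N Λ))) (h : I.carrier.Nonempty)
    (x : Δ.carrier) : ∃ g ∈ G, g ∈ I.carrier ∧
      (∀ F ∈ I.carrier, (F : N →ᵃ[ℝ] ℝ) x ≤ (g : N →ᵃ[ℝ] ℝ) x) ∧
      evFun I x = (g : N →ᵃ[ℝ] ℝ) x := by
  have hne : G.Nonempty := by
    rw [hI] at h
    exact h.of_add_left
  obtain ⟨g, hg, hmax⟩ := Set.exists_max_image G (fun F => (F : N →ᵃ[ℝ] ℝ) x) hG hne
  have hgI : g ∈ I.carrier := by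
    rw [hI]
    exact ⟨g, hg, 0, Δ.nonpos.zero_mem, add_zero g⟩
  have hub : ∀ F ∈ I.carrier, (F : N →ᵃ[ℝ] ℝ) x ≤ (g : N →ᵃ[ℝ] ℝ) x := by
    intro F hF
    rw [hI] at hF
    obtain ⟨a, ha, q, hq, rfl⟩ := hF
    have h₁ : (q : N →ᵃ[ℝ] ℝ) x ≤ 0 := hq x x.2
    have h₂ := hmax a ha
    have h₃ : ((a + q : intAffine N Λ) : N →ᵃ[ℝ] ℝ) x
        = (a : N →ᵃ[ℝ] ℝ) x + (q : N →ᵃ[ℝ] ℝ) x := rfl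
    change ((a + q : intAffine N Λ) : N →ᵃ[ℝ] ℝ) x ≤ _
    linarith
  refine ⟨g, hg, hgI, hub, ?_⟩
  refine IsGreatest.csSup_eq ⟨⟨g, hgI, rfl⟩, ?_⟩
  rintro _ ⟨F, hF, rfl⟩
  exact hub F hF

theorem isGreatest_evFun {I : Δ.B} (h : I.carrier.Nonempty) (x : Δ.carrier) :
    IsGreatest ((fun F : intAffine N Λ => (F : N →ᵃ[ℝ] ℝ) x) '' I.carrier) (evFun I x) := by
  obtain ⟨G, hG, hI⟩ := I.fg
  obtain ⟨g, -, hgI, hub, he⟩ := exists_generator_isGreatest hG hI h x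
  rw [he]
  refine ⟨⟨g, hgI, rfl⟩, ?_⟩
  rintro _ ⟨F, hF, rfl⟩
  exact hub F hF

theorem isConvexFun_evFun {I : Δ.B} (h : I.carrier.Nonempty) : IsConvexFun Δ (evFun I) := by
  intro x y z t h0 h1 hz
  have h1' : 0 ≤ 1 - t := by linarith
  obtain ⟨F, hF, he⟩ := (isGreatest_evFun h z).1
  have hx := (isGreatest_evFun h x).2 ⟨F, hF, rfl⟩
  have hy := (isGreatest_evFun h y).2 ⟨F, hF, rfl⟩
  rw [← he]
  exact (isConvexFun_affine (F : N →ᵃ[ℝ] ℝ) x y z t h0 h1 hz).trans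
    (add_le_add (mul_le_mul_of_nonneg_left hx h1') (mul_le_mul_of_nonneg_left hy h0))

theorem isPiecewiseIntAffine_evFun {I : Δ.B} (h : I.carrier.Nonempty) :
    IsPiecewiseIntAffine Δ (evFun I) := by
  obtain ⟨G, hG, hI⟩ := I.fg
  refine ⟨(fun g : intAffine N Λ =>
    ({x | ∀ F ∈ G, (F : N →ᵃ[ℝ] ℝ) x ≤ (g : N →ᵃ[ℝ] ℝ) x}, g)) '' G, hG.image _, ?_, ?_, ?_⟩
  · rintro _ ⟨g, _, rfl⟩
    refine ⟨(fun F : intAffine N Λ => (F : N →ᵃ[ℝ] ℝ) - (g : N →ᵃ[ℝ] ℝ)) '' G, hG.image _, ?_⟩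
    ext x
    exact (Set.forall_mem_image.trans (forall₂_congr fun F _ => sub_nonpos)).symm
  · intro x
    obtain ⟨g, hg, -, hub, -⟩ := exists_generator_isGreatest hG hI h x
    refine ⟨_, ⟨g, hg, rfl⟩, fun F hF => hub F ?_⟩
    rw [hI]
    exact ⟨F, hF, 0, Δ.nonpos.zero_mem, add_zero F⟩
  · rintro _ ⟨g, hg, rfl⟩ x hx
    obtain ⟨g', hg', -, hub, he⟩ := exists_generator_isGreatest hG hI h x
    rw [he]
    refine le_antisymm (hx g' hg') (hub g ?_)
    rw [hI]
    exact ⟨g, hg, 0, Δ.nonpos.zero_mem, add_zero g⟩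

/-- The value of the evaluation map on a nonempty fractional ideal. -/
noncomputable def evCPAFun (I : Δ.B) (h : I.carrier.Nonempty) : CPAFun Δ :=
  ⟨evFun I, isConvexFun_evFun h, isPiecewiseIntAffine_evFun h⟩

open Classical in
/-- The evaluation map as a function: `-∞` goes to `-∞`, and a nonempty fractional ideal goes to
the pointwise supremum of its members. -/
noncomputable def evMap (I : Δ.B) : CPA Δ :=
  if h : I.carrier.Nonempty then CPA.ofFun (evCPAFun I h) else 0

theorem evMap_of_nonempty {I : Δ.B} (h : I.carrier.Nonempty) :
    evMap I = CPA.ofFun (evCPAFun I h) := dif_pos h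

theorem evMap_zero : evMap (0 : Δ.B) = 0 :=
  dif_neg (by rw [FracIdeal.carrier_zero]; exact Set.not_nonempty_empty)

theorem eq_zero_or_nonempty (I : Δ.B) : I = 0 ∨ I.carrier.Nonempty := by
  rcases Set.eq_empty_or_nonempty I.carrier with h | h
  · exact Or.inl (FracIdeal.ext h)
  · exact Or.inr h

variable (Δ) in
/-- The evaluation homomorphism `ev : B[Q; Q⁺] → CPA_ℤ(Δ, ℝ)`. -/
noncomputable def ev : Δ.B →+* CPA Δ where
  toFun := evMap
  map_zero' := evMap_zero
  map_one' := by
    have h : (1 : Δ.B).carrier.Nonempty := ⟨0, Δ.nonpos.zero_mem⟩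
    rw [evMap_of_nonempty h, CPA.one_eq]
    refine congrArg _ (Subtype.ext (funext fun x => ?_))
    refine (isGreatest_evFun h x).unique ⟨⟨0, Δ.nonpos.zero_mem, rfl⟩, ?_⟩
    rintro _ ⟨F, hF, rfl⟩
    exact hF x x.2
  map_add' I J := by
    rcases eq_zero_or_nonempty I with rfl | hI
    · rw [zero_add, evMap_zero, zero_add]
    rcases eq_zero_or_nonempty J with rfl | hJ
    · rw [add_zero, evMap_zero, add_zero]
    have h : (I + J).carrier.Nonempty := hI.mono Set.subset_union_left
    rw [evMap_of_nonempty hI, evMap_of_nonempty hJ, evMap_of_nonempty h, CPA.ofFun_add]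
    refine congrArg _ (Subtype.ext (funext fun x => ?_))
    refine (isGreatest_evFun h x).unique ?_
    rw [FracIdeal.carrier_add_eq, Set.image_union]
    exact (isGreatest_evFun hI x).union (isGreatest_evFun hJ x)
  map_mul' I J := by
    rcases eq_zero_or_nonempty I with rfl | hI
    · rw [zero_mul, evMap_zero, zero_mul]
    rcases eq_zero_or_nonempty J with rfl | hJ
    · rw [mul_zero, evMap_zero, mul_zero]
    have h : (I * J).carrier.Nonempty := hI.add hJ
    rw [evMap_of_nonempty hI, evMap_of_nonempty hJ, evMap_of_nonempty h, CPA.ofFun_mul]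
    refine congrArg _ (Subtype.ext (funext fun x => ?_))
    refine (isGreatest_evFun h x).unique ?_
    obtain ⟨⟨F, hF, hFe⟩, hFu⟩ := isGreatest_evFun hI x
    obtain ⟨⟨F', hF', hFe'⟩, hFu'⟩ := isGreatest_evFun hJ x
    refine ⟨⟨F + F', ⟨F, hF, F', hF', rfl⟩, congrArg₂ (· + ·) hFe hFe'⟩, ?_⟩
    rintro _ ⟨_, ⟨A, hA, B, hB, rfl⟩, rfl⟩
    exact add_le_add (hFu ⟨A, hA, rfl⟩) (hFu' ⟨B, hB, rfl⟩)

theorem exists_le_const [FiniteDimensional ℝ V] (Δ : RatPolytope N Λ) (F : N →ᵃ[ℝ] ℝ) :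
    ∃ c : ℝ, ∀ x ∈ Δ.carrier, F x ≤ c := by
  have : Nonempty N := NormedAddTorsor.toAddTorsor.nonempty
  obtain ⟨p⟩ := this
  obtain ⟨r, hr⟩ := (Metric.isBounded_iff_subset_closedBall p).1 Δ.isBounded
  obtain ⟨C, hC₀, hC⟩ := (LinearMap.toContinuousLinearMap F.linear).isBoundedLinearMap.bound
  refine ⟨C * r + F p, fun x hx => ?_⟩
  have h₁ : F x = F.linear (x -ᵥ p) + F p := by
    rw [AffineMap.linearMap_vsub]; simp
  have h₂ : dist x p ≤ r := hr hx
  rw [dist_eq_norm_vsub V] at h₂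
  have h₃ : ‖F.linear (x -ᵥ p)‖ ≤ C * ‖x -ᵥ p‖ := hC (x -ᵥ p)
  have h₄ := (le_abs_self (F.linear (x -ᵥ p))).trans (h₃.trans (mul_le_mul_of_nonneg_left h₂ hC₀.le))
  linarith

/-- A principal fractional ideal, as an invertible element of `B[Q; Q⁺]`. -/
def principalUnit (F : intAffine N Λ) : (Δ.B)ˣ where
  val := FracIdeal.principal _ F
  inv := FracIdeal.principal _ (-F)
  val_inv := by rw [FracIdeal.principal_mul_principal, add_neg_cancel, FracIdeal.principal_zero]
  inv_val := by rw [FracIdeal.principal_mul_principal, neg_add_cancel, FracIdeal.principal_zero]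

/-- The restriction of an affine function, as an invertible element of `CPA_ℤ(Δ, ℝ)`. -/
def affineUnit (F : intAffine N Λ) : (CPA Δ)ˣ where
  val := CPA.ofFun (CPAFun.ofAffine F)
  inv := CPA.ofFun (CPAFun.ofAffine (-F))
  val_inv := by
    rw [CPA.ofFun_mul, CPA.one_eq]
    exact congrArg _ (Subtype.ext (funext fun x => add_neg_cancel ((F : N →ᵃ[ℝ] ℝ) x)))
  inv_val := by
    rw [CPA.ofFun_mul, CPA.one_eq]
    exact congrArg _ (Subtype.ext (funext fun x => neg_add_cancel ((F : N →ᵃ[ℝ] ℝ) x)))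

theorem exists_finite_bound [FiniteDimensional ℝ V] (Δ : RatPolytope N Λ)
    {G : Set (intAffine N Λ)} (hG : G.Finite) :
    ∃ c : ℝ, ∀ g ∈ G, ∀ x ∈ Δ.carrier, (g : N →ᵃ[ℝ] ℝ) x ≤ c := by
  choose c hc using fun g : intAffine N Λ => exists_le_const Δ (g : N →ᵃ[ℝ] ℝ)
  obtain ⟨b, hb⟩ := (hG.image c).bddAbove
  exact ⟨b, fun g hg x hx => (hc g x hx).trans (hb ⟨g, hg, rfl⟩)⟩

instance [FiniteDimensional ℝ V] : Tate Δ.B where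
  exists_le_unit I := by
    obtain ⟨G, hG, hI⟩ := I.fg
    obtain ⟨c, hc⟩ := exists_finite_bound Δ hG
    refine ⟨principalUnit (intAffineConst N Λ c), ?_⟩
    rw [FracIdeal.le_def, hI]
    rintro _ ⟨g, hg, q, hq, rfl⟩
    refine FracIdeal.mem_principal.2 ⟨(g - intAffineConst N Λ c) + q, ?_, ?_⟩
    · refine Δ.nonpos.add_mem (fun x hx => ?_) hq
      exact sub_nonpos.2 (hc g hg x hx)
    · change intAffineConst N Λ c + ((g - intAffineConst N Λ c) + q) = g + q
      abel

instance [FiniteDimensional ℝ V] : Tate (CPA Δ) where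
  exists_le_unit f := by
    induction f using WithBot.recBotCoe with
    | bot => exact ⟨1, bot_le (α := WithBot (CPAFun Δ))⟩
    | coe f =>
      obtain ⟨A, hA, -, hA₂, hA₃⟩ := f.2.2
      obtain ⟨c, hc⟩ := exists_finite_bound Δ (hA.image Prod.snd)
      refine ⟨affineUnit (intAffineConst N Λ c), WithBot.coe_le_coe.2 fun x => ?_⟩
      obtain ⟨p, hp, hx⟩ := hA₂ x
      exact (hA₃ p hp x hx).le.trans (hc p.2 ⟨p, hp, rfl⟩ x x.2)

end Polytope

end IdempotentSemiring

/-!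
The map `ev` is surjective, and the order it pulls back to `B[Q; Q⁺]` is integral dependence:
`ev X ≤ ev Y` holds if and only if `X * S ≤ Y * S` for some bounded `S`. Everything else is formal.
Surjectivity and this description of the fibres identify `CPA_ℤ(Δ, ℝ)` with the image of
`B[Q; Q⁺]` in its localisation `PL`; in a normal semiring bounded elements can be cancelled from
inequalities (`IsNormal.le_of_mul_le_mul`), so every homomorphism to a normal semiring factors
through `ev`; and the integral closure of the ideal generated by `X` is `{Y | ev Y ≤ ev X}`.

One direction (`ev_le_of_mul_le_mul`) holds because a bounded element of `CPA_ℤ(Δ, ℝ)` is a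
real-valued function and can be subtracted. For the other (`exists_bounded_mul_le_of_ev_le`) let
`F ∈ Q` with `F ≤ max_j G_j` on `Δ`, where the `G_j` generate `Y`. Farkas' lemma yields real weights
`c_j ≥ 0` of sum `1` with `F ≤ ∑ c_j G_j` on `Δ`, the inequality being witnessed by a linear
relation between the slopes of the `G_j - F` and of the functions that cut out `Δ`
(`exists_affine_certificate`). The slopes are integral on `Λ`, so the weights can be made rational
(`exists_nat_relation`), although the constants are arbitrary reals. Clearing denominators gives
`n F ≤ ∑ n_j G_j` with `n = ∑ n_j > 0`, that is `x ^ n ≤ Y ^ n` for the principal element `x` of `F`,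
and then `S = (x + Y) ^ (n - 1)` satisfies `x * S ≤ Y * S` (`mul_add_pow_le_of_pow_le`).

Surjectivity (`ev_surjective`) says that a convex piecewise affine function is the maximum of those
of its pieces that lie below it everywhere; that these suffice is `exists_affine_le`.
-/

namespace IdempotentSemiring

/-! ### Farkas' lemma and rational relations -/

section Farkas

/-- **Farkas' lemma** for finitely many linear functionals on an arbitrary real vector space,
proved by induction on their number. -/
theorem exists_nonneg_combination {E ι : Type*} [AddCommGroup E] [Module ℝ E] (s : Finset ι)
    (A : ι → E →ₗ[ℝ] ℝ) (γ : E →ₗ[ℝ] ℝ) (h : ∀ x, (∀ i ∈ s, A i x ≤ 0) → γ x ≤ 0) :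
    ∃ c : ι → ℝ, (∀ i, 0 ≤ c i) ∧ γ = ∑ i ∈ s, c i • A i := by
  classical
  induction s using Finset.induction_on generalizing A γ with
  | empty =>
    refine ⟨0, fun _ => le_rfl, LinearMap.ext fun x => ?_⟩
    have h₁ := h x (by simp)
    have h₂ := h (-x) (by simp)
    rw [map_neg] at h₂
    simp only [Finset.sum_empty, LinearMap.zero_apply]
    linarith
  | insert a s ha ih =>
    by_cases h' : ∀ x, (∀ i ∈ s, A i x ≤ 0) → γ x ≤ 0
    · obtain ⟨c, hc, he⟩ := ih A γ h'
      refine ⟨Function.update c a 0, fun i => ?_, ?_⟩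
      · by_cases hi : i = a
        · simp [hi]
        · simpa [hi] using hc i
      · rw [Finset.sum_insert ha, he]
        simp only [Function.update_self, zero_smul, zero_add]
        refine Finset.sum_congr rfl fun i hi => ?_
        rw [Function.update_of_ne (ne_of_mem_of_not_mem hi ha)]
    · push Not at h'
      obtain ⟨x₀, hx₀, hγ⟩ := h'
      have hpos : 0 < A a x₀ := by
        by_contra hle
        refine absurd (h x₀ fun i hi => ?_) (not_le.2 hγ)
        rcases Finset.mem_insert.1 hi with rfl | hi
        exacts [not_lt.1 hle, hx₀ i hi]
      -- Along `x₀` all functionals are projected to ones vanishing at `x₀`.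
      obtain ⟨c, hc, he⟩ := ih (fun i => A i - (A i x₀ / A a x₀) • A a)
        (γ - (γ x₀ / A a x₀) • A a) fun x hx => by
          have := h (x - (A a x / A a x₀) • x₀) fun i hi => by
            rcases Finset.mem_insert.1 hi with rfl | hi
            · simp only [map_sub, map_smul, smul_eq_mul]
              rw [div_mul_cancel₀ _ hpos.ne', sub_self]
            · refine le_of_eq_of_le ?_ (hx i hi)
              simp only [map_sub, map_smul, smul_eq_mul, LinearMap.sub_apply,
                LinearMap.smul_apply]
              ring
          refine le_of_eq_of_le ?_ this
          simp only [map_sub, map_smul, smul_eq_mul, LinearMap.sub_apply, LinearMap.smul_apply]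
          ring
      refine ⟨Function.update c a ((γ x₀ - ∑ i ∈ s, c i * A i x₀) / A a x₀), fun i => ?_, ?_⟩
      · by_cases hi : i = a
        · subst hi
          rw [Function.update_self]
          refine div_nonneg (sub_nonneg.2 (le_trans ?_ hγ.le)) hpos.le
          exact Finset.sum_nonpos fun j hj => mul_nonpos_of_nonneg_of_nonpos (hc j) (hx₀ j hj)
        · simpa [hi] using hc i
      · rw [Finset.sum_insert ha, Function.update_self]
        have h₁ : ∑ i ∈ s, Function.update c a ((γ x₀ - ∑ i ∈ s, c i * A i x₀) / A a x₀) i • A i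
            = ∑ i ∈ s, c i • A i := Finset.sum_congr rfl fun i hi => by
          rw [Function.update_of_ne (ne_of_mem_of_not_mem hi ha)]
        rw [h₁]
        ext x
        have h₂ := LinearMap.congr_fun he x
        simp only [LinearMap.sub_apply, LinearMap.smul_apply, smul_eq_mul, LinearMap.sum_apply,
          mul_sub, Finset.sum_sub_distrib] at h₂
        simp only [LinearMap.add_apply, LinearMap.smul_apply, smul_eq_mul, LinearMap.sum_apply]
        have h₃ : ∑ i ∈ s, c i * (A i x₀ / A a x₀ * A a x)
            = (∑ i ∈ s, c i * A i x₀) / A a x₀ * A a x := by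
          rw [Finset.sum_div, Finset.sum_mul]
          exact Finset.sum_congr rfl fun i _ => by ring
        rw [h₃] at h₂
        rw [sub_div, sub_mul]
        linarith

end Farkas

section Rationality

variable {V : Type*} [AddCommGroup V] [Module ℝ V]

/-- Nonnegative rational numbers have a common denominator. -/
theorem exists_nat_multiples {ι : Type*} [Fintype ι] (y : ι → ℚ) (hy : ∀ i, 0 ≤ y i) :
    ∃ (D : ℕ) (n : ι → ℕ), 0 < D ∧ ∀ i, (n i : ℚ) = D * y i := by
  refine ⟨∏ i, (y i).den, fun i => (y i).num.toNat * ((∏ j, (y j).den) / (y i).den),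
    Finset.prod_pos fun i _ => (y i).pos, fun i => ?_⟩
  obtain ⟨k, hk⟩ := Finset.dvd_prod_of_mem (fun j => (y j).den) (Finset.mem_univ i)
  have h₀ : (∏ j, (y j).den) / (y i).den = k := by rw [hk, Nat.mul_div_cancel_left _ (y i).pos]
  change (((y i).num.toNat * ((∏ j, (y j).den) / (y i).den) : ℕ) : ℚ) = _
  rw [h₀, hk]
  have h₁ : (((y i).num.toNat : ℤ) : ℚ) = (y i).num := by
    rw [Int.toNat_of_nonneg (Rat.num_nonneg.2 (hy i))]
  have h₂ := Rat.mul_den_eq_num (y i)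
  push_cast at h₁ ⊢
  rw [h₁, ← h₂]
  ring

/-- A real nonnegative relation between functionals which are integral on a lattice can be replaced
by a relation with natural coefficients that are positive where the real ones are, and for which
a prescribed linear form `b` stays nonnegative. The weights `w` are expanded in a `ℚ`-basis of
their `ℚ`-span: the rational coordinate vectors satisfy the same relation, and so do all their real
combinations, in particular the rational ones near `w`. -/
theorem exists_nat_relation {ι : Type*} [Fintype ι] (Λ : Submodule ℤ V)
    (hΛ : Submodule.span ℝ (Λ : Set V) = ⊤) (a : ι → V →ₗ[ℝ] ℝ)
    (ha : ∀ i, ∀ v ∈ Λ, ∃ m : ℤ, a i v = m) (b w : ι → ℝ) (hw : ∀ i, 0 ≤ w i)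
    (hrel : ∑ i, w i • a i = 0) (hb : 0 ≤ ∑ i, w i * b i) :
    ∃ n : ι → ℕ, (∀ i, 0 < w i → 0 < n i) ∧ ∑ i, (n i : ℝ) • a i = 0 ∧
      0 ≤ ∑ i, (n i : ℝ) * b i := by
  let W : Submodule ℚ ℝ := Submodule.span ℚ (Set.range w)
  have : FiniteDimensional ℚ W := FiniteDimensional.span_of_finite ℚ (Set.finite_range w)
  let c := Module.finBasis ℚ W
  let w' : ι → W := fun i => ⟨w i, Submodule.subset_span ⟨i, rfl⟩⟩
  let q : ι → Fin (Module.finrank ℚ W) → ℚ := fun i k => c.repr (w' i) k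
  let φ : ι → (Fin (Module.finrank ℚ W) → ℝ) → ℝ := fun i d => ∑ k, (q i k : ℝ) * d k
  have hφc : ∀ i, φ i (fun k => (c k : ℝ)) = w i := fun i => by
    have h₁ := congrArg (Subtype.val : W → ℝ) (c.sum_repr (w' i))
    rw [AddSubmonoidClass.coe_finsetSum] at h₁
    refine Eq.trans (Finset.sum_congr rfl fun k _ => ?_) h₁
    rw [Submodule.coe_smul, Rat.smul_def]
  have hφ0 : ∀ i, w i = 0 → ∀ d, φ i d = 0 := fun i hi d => by
    have h₁ : w' i = 0 := Subtype.ext hi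
    simp [φ, q, h₁]
  have hφcont : ∀ i, Continuous (φ i) := fun i => by fun_prop
  have hφrel : ∀ d, ∑ i, φ i d • a i = 0 := fun d => by
    refine LinearMap.ext_on hΛ fun v hv => ?_
    choose m hm using fun i => ha i v hv
    have h₁ : ∑ i, (m i : ℚ) • w' i = 0 := by
      refine Subtype.ext ?_
      rw [AddSubmonoidClass.coe_finsetSum]
      have h₂ := LinearMap.congr_fun hrel v
      simp only [LinearMap.sum_apply, LinearMap.smul_apply, smul_eq_mul, hm,
        LinearMap.zero_apply] at h₂
      refine Eq.trans (Finset.sum_congr rfl fun i _ => ?_) h₂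
      rw [Submodule.coe_smul, Rat.smul_def, mul_comm]
      simp [w']
    have h₂ : ∀ k, ∑ i, (m i : ℚ) * q i k = 0 := fun k => by
      have := congrArg (fun z => c.repr z k) h₁
      simpa [map_sum, Finsupp.finsetSum_apply, q] using this
    have h₃ : ∀ k, ∑ i, (m i : ℝ) * (q i k : ℝ) = 0 := fun k => by exact_mod_cast h₂ k
    simp only [LinearMap.sum_apply, LinearMap.smul_apply, smul_eq_mul, hm, LinearMap.zero_apply, φ,
      Finset.sum_mul]
    rw [Finset.sum_comm]
    refine Finset.sum_eq_zero fun k _ => ?_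
    rw [← mul_zero (d k), ← h₃ k, Finset.mul_sum]
    exact Finset.sum_congr rfl fun i _ => by ring
  let ψ : (Fin (Module.finrank ℚ W) → ℝ) → ℝ := fun d => ∑ i, φ i d * b i
  have hψcont : Continuous ψ := by fun_prop
  have hφlin : ∀ i d e (t : ℝ), φ i (d + t • e) = φ i d + t * φ i e := fun i d e t => by
    simp only [φ, Pi.add_apply, Pi.smul_apply, smul_eq_mul, mul_add, Finset.sum_add_distrib,
      Finset.mul_sum]
    congr 1
    exact Finset.sum_congr rfl fun k _ => by ring
  have hψlin : ∀ d e (t : ℝ), ψ (d + t • e) = ψ d + t * ψ e := fun d e t => by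
    simp only [ψ, hφlin, add_mul, Finset.sum_add_distrib, Finset.mul_sum, mul_assoc]
  let U : Set (Fin (Module.finrank ℚ W) → ℝ) := ⋂ i ∈ {i | 0 < w i}, {d | 0 < φ i d}
  have hU : IsOpen U := (Set.toFinite _).isOpen_biInter fun i _ =>
    isOpen_lt continuous_const (hφcont i)
  have hcU : (fun k => (c k : ℝ)) ∈ U := Set.mem_iInter₂.2 fun i hi => by
    simpa only [Set.mem_ofPred_eq, hφc] using hi
  have hψc : 0 ≤ ψ (fun k => (c k : ℝ)) := by simpa only [ψ, hφc] using hb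
  have hdense : DenseRange (fun (r : Fin (Module.finrank ℚ W) → ℚ) k => (r k : ℝ)) :=
    DenseRange.piMap fun _ => Rat.denseRange_cast
  obtain ⟨r, hrU, hrψ⟩ : ∃ r : Fin (Module.finrank ℚ W) → ℚ, (fun k => (r k : ℝ)) ∈ U ∧
      0 ≤ ψ fun k => (r k : ℝ) := by
    by_cases hψ : ∀ d, ψ d = 0
    · obtain ⟨r, hr⟩ := hdense.exists_mem_open hU ⟨_, hcU⟩
      exact ⟨r, hr, (hψ _).ge⟩
    · -- If `ψ` does not vanish identically, it is positive at some point close to `c`.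
      obtain ⟨e, he⟩ : ∃ e, 0 < ψ e := by
        push Not at hψ
        obtain ⟨e, he⟩ := hψ
        rcases he.lt_or_gt with h | h
        · refine ⟨0 + (-1 : ℝ) • e, ?_⟩
          rw [hψlin]
          have : ψ 0 = 0 := by simp [ψ, φ]
          linarith
        · exact ⟨e, h⟩
      have hcont : Continuous fun t : ℝ => (fun k => (c k : ℝ)) + t • e := by fun_prop
      have hev : ∀ᶠ t in nhdsWithin (0 : ℝ) (Set.Ioi 0), (fun k => (c k : ℝ)) + t • e ∈ U :=
        (hcont.continuousAt.eventually_mem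
          (hU.mem_nhds (by simpa using hcU))).filter_mono nhdsWithin_le_nhds
      obtain ⟨t, htU, ht⟩ := (hev.and self_mem_nhdsWithin).exists
      obtain ⟨r, hr⟩ := hdense.exists_mem_open (hU.inter (isOpen_lt continuous_const hψcont))
        ⟨_, htU, show 0 < ψ ((fun k => (c k : ℝ)) + t • e) by
          rw [hψlin]
          exact add_pos_of_nonneg_of_pos hψc (mul_pos ht he)⟩
      exact ⟨r, hr.1, le_of_lt hr.2⟩
  let y : ι → ℚ := fun i => ∑ k, q i k * r k
  have hy : ∀ i, (y i : ℝ) = φ i fun k => (r k : ℝ) := fun i => by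
    simp only [y, φ]
    push_cast
    rfl
  have hypos : ∀ i, 0 < w i → 0 < y i := fun i hi => by
    have : 0 < φ i fun k => (r k : ℝ) := Set.mem_iInter₂.1 hrU i hi
    rw [← hy] at this
    exact_mod_cast this
  have hynn : ∀ i, 0 ≤ y i := fun i => by
    rcases (hw i).lt_or_eq with h | h
    · exact (hypos i h).le
    · have := hy i
      rw [hφ0 i h.symm] at this
      exact le_of_eq (by exact_mod_cast this.symm)
  obtain ⟨D, n, hD, hn⟩ := exists_nat_multiples y hynn
  have hn' : ∀ i, (n i : ℝ) = D * φ i fun k => (r k : ℝ) := fun i => by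
    rw [← hy]
    exact_mod_cast hn i
  refine ⟨n, fun i hi => ?_, ?_, ?_⟩
  · have : (0 : ℚ) < n i := by
      rw [hn]
      exact mul_pos (by exact_mod_cast hD) (hypos i hi)
    exact_mod_cast this
  · simp only [hn', mul_smul, ← Finset.smul_sum, hφrel, smul_zero]
  · simp only [hn', mul_assoc, ← Finset.mul_sum]
    exact mul_nonneg D.cast_nonneg hrψ

end Rationality

/-! ### Inequalities between affine functions on a polytope -/

section AffineCertificate

variable {V N : Type*} [NormedAddCommGroup V] [NormedSpace ℝ V] [MetricSpace N]
  [NormedAddTorsor V N]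

theorem apply_eq_linear_add (F : N →ᵃ[ℝ] ℝ) (x p : N) : F x = F.linear (x -ᵥ p) + F p := by
  rw [AffineMap.linearMap_vsub]; simp

/-- If `f i ≤ 0` for all `i` defines a nonempty bounded set on which the maximum of the `g j` is
nonnegative, then some convex combination of the `g j` differs from a nonpositive combination of
the `f i` by a nonnegative constant. This is Farkas' lemma on `V × ℝ × ℝ`, where the first real
coordinate homogenises the affine functions and the second one is a slack in `g j + s ≤ 0`;
boundedness rules out directions at infinity. -/
theorem exists_affine_certificate {I J : Type*} [Fintype I] [Fintype J] (f : I → N →ᵃ[ℝ] ℝ)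
    (g : J → N →ᵃ[ℝ] ℝ) (hbd : Bornology.IsBounded {x | ∀ i, f i x ≤ 0}) (p : N)
    (hp : ∀ i, f i p ≤ 0) (h : ∀ x, (∀ i, f i x ≤ 0) → ∃ j, 0 ≤ g j x) :
    ∃ (c : J → ℝ) (e : I → ℝ), (∀ j, 0 ≤ c j) ∧ (∀ i, 0 ≤ e i) ∧ ∑ j, c j = 1 ∧
      ∑ j, c j • (g j).linear + ∑ i, e i • (f i).linear = 0 ∧
      0 ≤ ∑ j, c j * g j p + ∑ i, e i * f i p := by
  let v : V × ℝ × ℝ →ₗ[ℝ] V := LinearMap.fst ℝ V (ℝ × ℝ)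
  let t : V × ℝ × ℝ →ₗ[ℝ] ℝ := LinearMap.fst ℝ ℝ ℝ ∘ₗ LinearMap.snd ℝ V (ℝ × ℝ)
  let s : V × ℝ × ℝ →ₗ[ℝ] ℝ := LinearMap.snd ℝ ℝ ℝ ∘ₗ LinearMap.snd ℝ V (ℝ × ℝ)
  let A : Option (J ⊕ I) → V × ℝ × ℝ →ₗ[ℝ] ℝ := fun k => k.elim (-t) (Sum.elim
    (fun j => (g j).linear ∘ₗ v + g j p • t + s) (fun i => (f i).linear ∘ₗ v + f i p • t))
  obtain ⟨d, hd, he⟩ := exists_nonneg_combination Finset.univ A s (by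
    rintro ⟨v₀, t₀, s₀⟩ hx
    have ht : 0 ≤ t₀ := by simpa [A, t] using hx none (Finset.mem_univ _)
    have hg : ∀ j, (g j).linear v₀ + g j p * t₀ + s₀ ≤ 0 := fun j =>
      hx (some (Sum.inl j)) (Finset.mem_univ _)
    have hf : ∀ i, (f i).linear v₀ + f i p * t₀ ≤ 0 := fun i =>
      hx (some (Sum.inr i)) (Finset.mem_univ _)
    change s₀ ≤ 0
    rcases ht.lt_or_eq with ht | rfl
    · have hval : ∀ F : N →ᵃ[ℝ] ℝ, F (t₀⁻¹ • v₀ +ᵥ p) = t₀⁻¹ * (F.linear v₀ + F p * t₀) :=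
        fun F => by
          rw [apply_eq_linear_add F _ p, vadd_vsub, map_smul, smul_eq_mul]
          field_simp
      obtain ⟨j, hj⟩ := h (t₀⁻¹ • v₀ +ᵥ p) fun i => by
        rw [hval]
        exact mul_nonpos_of_nonneg_of_nonpos (inv_nonneg.2 ht.le) (hf i)
      rw [hval] at hj
      have := nonneg_of_mul_nonneg_right hj (inv_pos.2 ht)
      linarith [hg j]
    · have hv₀ : v₀ = 0 := by
        by_contra hne
        obtain ⟨r, hr⟩ := (Metric.isBounded_iff_subset_closedBall p).1 hbd
        obtain ⟨k, hk⟩ := exists_nat_gt (r / ‖v₀‖)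
        have hmem : (k : ℝ) • v₀ +ᵥ p ∈ {x | ∀ i, f i x ≤ 0} := fun i => by
          rw [apply_eq_linear_add (f i) _ p, vadd_vsub, map_smul, smul_eq_mul]
          have h₁ := hf i
          rw [mul_zero, add_zero] at h₁
          exact add_nonpos (mul_nonpos_of_nonneg_of_nonpos k.cast_nonneg h₁) (hp i)
        have h₂ : dist ((k : ℝ) • v₀ +ᵥ p) p ≤ r := hr hmem
        rw [dist_eq_norm_vsub V, vadd_vsub, norm_smul, Real.norm_natCast] at h₂
        rw [div_lt_iff₀ (norm_pos_iff.2 hne)] at hk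
        linarith
      obtain ⟨j, -⟩ := h p hp
      simpa [hv₀] using hg j)
  have he' : ∀ v₀ t₀ s₀, s₀ = d none * -t₀ +
      (∑ j, d (some (Sum.inl j)) * ((g j).linear v₀ + g j p * t₀ + s₀) +
        ∑ i, d (some (Sum.inr i)) * ((f i).linear v₀ + f i p * t₀)) := fun v₀ t₀ s₀ => by
    have h₁ := LinearMap.congr_fun he (v₀, t₀, s₀)
    rw [Fintype.sum_option, Fintype.sum_sum_type] at h₁
    simpa [A, v, t, s, mul_add] using h₁
  refine ⟨fun j => d (some (Sum.inl j)), fun i => d (some (Sum.inr i)), fun _ => hd _,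
    fun _ => hd _, ?_, ?_, ?_⟩
  · simpa using (he' 0 0 1).symm
  · ext v₀
    simpa using (he' v₀ 0 0).symm
  · have h₁ := he' 0 1 0
    simp only [map_zero, zero_add, mul_one, add_zero] at h₁
    linarith [hd none]

variable {Λ : Submodule ℤ V} {Δ : RatPolytope N Λ}

/-- Evaluation at a point, as an additive homomorphism. -/
def evalHom (Λ : Submodule ℤ V) (x : N) : intAffine N Λ →+ ℝ where
  toFun F := (F : N →ᵃ[ℝ] ℝ) x
  map_zero' := rfl
  map_add' _ _ := rfl

theorem evalHom_apply (x : N) (F : intAffine N Λ) : evalHom Λ x F = (F : N →ᵃ[ℝ] ℝ) x := rfl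

/-- If `F ≤ max_j G_j` on a nonempty rational polytope, then a positive multiple of `F` is bounded
there by a combination of the `G_j` with natural coefficients of the same total weight. -/
theorem exists_nsmul_le_sum_nsmul [FiniteDimensional ℝ V] [DiscreteTopology Λ] [IsZLattice ℝ Λ]
    {J : Type*} [Fintype J] (hΔ : Δ.carrier.Nonempty) (F : intAffine N Λ) (G : J → intAffine N Λ)
    (h : ∀ x ∈ Δ.carrier, ∃ j, (F : N →ᵃ[ℝ] ℝ) x ≤ (G j : N →ᵃ[ℝ] ℝ) x) :
    ∃ n : J → ℕ, 0 < ∑ j, n j ∧ (∑ j, n j) • F - ∑ j, n j • G j ∈ Δ.nonpos := by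
  obtain ⟨s, hs, hsQ, hΔs⟩ := Δ.cut_out
  have : Fintype s := hs.fintype
  have hmem : ∀ x, x ∈ Δ.carrier ↔ ∀ i : s, (i : N →ᵃ[ℝ] ℝ) x ≤ 0 := fun x => by
    rw [hΔs, Set.mem_ofPred_eq, Subtype.forall]
  obtain ⟨p, hp⟩ := hΔ
  obtain ⟨c, e, hc, he, hc₁, hrel, hb⟩ := exists_affine_certificate
    (fun i : s => (i : N →ᵃ[ℝ] ℝ)) (fun j => ((G j - F : intAffine N Λ) : N →ᵃ[ℝ] ℝ))
    (Δ.isBounded.subset fun x hx => (hmem x).2 hx) p ((hmem p).1 hp) fun x hx => by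
      obtain ⟨j, hj⟩ := h x ((hmem x).2 hx)
      exact ⟨j, sub_nonneg.2 hj⟩
  obtain ⟨n, hn, hnrel, hnb⟩ := exists_nat_relation Λ IsZLattice.span_top
    (Sum.elim (fun j => ((G j - F : intAffine N Λ) : N →ᵃ[ℝ] ℝ).linear)
      (fun i : s => (i : N →ᵃ[ℝ] ℝ).linear))
    (by
      rintro (j | i)
      exacts [(G j - F).2, hsQ _ i.2])
    (Sum.elim (fun j => ((G j - F : intAffine N Λ) : N →ᵃ[ℝ] ℝ) p)
      (fun i : s => (i : N →ᵃ[ℝ] ℝ) p))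
    (Sum.elim c e) (by rintro (j | i); exacts [hc j, he i])
    (by simpa [Fintype.sum_sum_type] using hrel) (by simpa [Fintype.sum_sum_type] using hb)
  rw [Fintype.sum_sum_type] at hnrel hnb
  refine ⟨fun j => n (Sum.inl j), ?_, fun x hx => ?_⟩
  · obtain ⟨j, -, hj⟩ := Finset.exists_lt_of_sum_lt
      (show ∑ _j : J, (0 : ℝ) < ∑ j, c j by rw [hc₁]; simp)
    exact Finset.sum_pos' (fun _ _ => Nat.zero_le _) ⟨j, Finset.mem_univ _, hn (Sum.inl j) hj⟩
  · have h₁ := LinearMap.congr_fun hnrel (x -ᵥ p)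
    simp only [Sum.elim_inl, Sum.elim_inr, LinearMap.add_apply, LinearMap.sum_apply,
      LinearMap.smul_apply, smul_eq_mul, LinearMap.zero_apply] at h₁ hnb
    have h₂ : ∑ i : s, (n (Sum.inr i) : ℝ) * (i : N →ᵃ[ℝ] ℝ) x ≤ 0 :=
      Finset.sum_nonpos fun i _ =>
        mul_nonpos_of_nonneg_of_nonpos (Nat.cast_nonneg _) ((hmem x).1 hx i)
    have h₃ : 0 ≤ ∑ j, (n (Sum.inl j) : ℝ) * ((G j - F : intAffine N Λ) : N →ᵃ[ℝ] ℝ) x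
        + ∑ i : s, (n (Sum.inr i) : ℝ) * (i : N →ᵃ[ℝ] ℝ) x := by
      simp only [fun j => apply_eq_linear_add ((G j - F : intAffine N Λ) : N →ᵃ[ℝ] ℝ) x p,
        fun i : s => apply_eq_linear_add (i : N →ᵃ[ℝ] ℝ) x p, mul_add, Finset.sum_add_distrib]
      linarith
    have h₄ : ∀ j, ((G j - F : intAffine N Λ) : N →ᵃ[ℝ] ℝ) x
        = evalHom Λ x (G j) - evalHom Λ x F := fun j => rfl
    simp only [h₄, mul_sub, Finset.sum_sub_distrib] at h₃
    rw [← evalHom_apply, map_sub, map_nsmul, map_sum]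
    simp only [map_nsmul, nsmul_eq_mul, Nat.cast_sum, Finset.sum_mul]
    linarith

end AffineCertificate

/-! ### Bounded elements and integral dependence -/

section Semiring

variable {α β : Type*} [IdemCommSemiring α] [IdemCommSemiring β]

theorem ringHom_monotone (f : α →+* β) {x y : α} (h : x ≤ y) : f x ≤ f y := by
  rw [← add_eq_right_iff_le] at h ⊢
  rw [← map_add, h]

theorem Bounded.map (f : α →+* β) {x : α} (h : Bounded x) : Bounded (f x) := by
  obtain ⟨u, v, hu, hv⟩ := h
  exact ⟨Units.map (f : α →* β) u, Units.map (f : α →* β) v, ringHom_monotone f hu, ringHom_monotone f hv⟩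

theorem Bounded.one : Bounded (1 : α) := (boundedSubmonoid α).one_mem

theorem Bounded.mul {x y : α} (hx : Bounded x) (hy : Bounded y) : Bounded (x * y) :=
  (boundedSubmonoid α).mul_mem hx hy

theorem Bounded.pow {x : α} (hx : Bounded x) (n : ℕ) : Bounded (x ^ n) :=
  (boundedSubmonoid α).pow_mem hx n

theorem mul_add_pow_le (x y : α) (m : ℕ) : x * (x + y) ^ m ≤ y * (x + y) ^ m + x ^ (m + 1) := by
  induction m with
  | zero => simp
  | succ m ih =>
    have hx : x ≤ x + y := by rw [add_eq_sup]; exact le_sup_left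
    calc x * (x + y) ^ (m + 1) = x * (x + y) ^ m * (x + y) := by ring
      _ ≤ (y * (x + y) ^ m + x ^ (m + 1)) * (x + y) := mul_le_mul_left ih _
      _ = y * (x + y) ^ (m + 1) + x ^ (m + 2) + y * x ^ (m + 1) := by ring
      _ ≤ y * (x + y) ^ (m + 1) + x ^ (m + 2) + y * (x + y) ^ (m + 1) := by gcongr
      _ = y * (x + y) ^ (m + 1) + x ^ (m + 2) := by
        rw [add_right_comm, add_idem]

/-- An inequality between powers is an equation of integral dependence: it becomes an inequality
after multiplication by a power of the sum. -/
theorem mul_add_pow_le_of_pow_le {x y : α} {m : ℕ} (h : x ^ (m + 1) ≤ y ^ (m + 1)) :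
    x * (x + y) ^ m ≤ y * (x + y) ^ m := by
  have hy : y ≤ x + y := by rw [add_eq_sup]; exact le_sup_right
  refine (mul_add_pow_le x y m).trans (add_le le_rfl (h.trans ?_))
  rw [pow_succ']
  gcongr

/-- In a normal semiring, bounded elements are cancellable in inequalities. -/
theorem IsNormal.le_of_mul_le_mul (h : IsNormal α) {x y s : α} (hs : Bounded s)
    (hxy : x * s ≤ y * s) : x ≤ y := by
  refine (le_sup_left.trans (add_eq_sup x y).ge).trans ?_
  refine h y (Order.Ideal.principal (x + y)) ⟨?_, fun z hz => ?_⟩ Order.Ideal.mem_principal_self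
  · exact Order.Ideal.principal_le_iff.2 (le_sup_right.trans (add_eq_sup x y).ge)
  · refine ⟨s, hs, y, Order.Ideal.mem_principal_self, ?_⟩
    refine (mul_le_mul_left (Order.Ideal.mem_principal.1 hz) s).trans ?_
    rw [add_mul]
    exact add_le hxy le_rfl

theorem isNormal_of_cancel (h : ∀ x y s : α, Bounded s → x * s ≤ y * s → x ≤ y) : IsNormal α := by
  rintro X κ ⟨-, hκ⟩ Z hZ
  obtain ⟨S, hS, Y, hY, hle⟩ := hκ Z hZ
  exact Order.Ideal.mem_principal.2 ((h Z Y S hS hle).trans (Order.Ideal.mem_principal.1 hY))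

end Semiring

/-! ### Factorisation through surjective homomorphisms -/

section Lift

/-- A homomorphism that respects the fibres of a surjective one factors through it. -/
theorem exists_comp_eq {α β γ : Type*} [Semiring α] [Semiring β] [Semiring γ] {f : α →+* β}
    (hf : Function.Surjective f) (g : α →+* γ) (h : ∀ x y, f x = f y → g x = g y) :
    ∃ k : β →+* γ, k.comp f = g := by
  have hk : ∀ x, g (Function.surjInv hf (f x)) = g x := fun x => h _ _ (Function.surjInv_eq hf _)
  refine ⟨⟨⟨⟨fun b => g (Function.surjInv hf b), ?_⟩, ?_⟩, ?_, ?_⟩, RingHom.ext hk⟩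
  · rw [← map_one f, hk, map_one]
  · intro a b
    obtain ⟨x, rfl⟩ := hf a
    obtain ⟨y, rfl⟩ := hf b
    simp only [← map_mul, hk]
  · change g (Function.surjInv hf 0) = 0
    rw [← map_zero f, hk, map_zero]
  · intro a b
    obtain ⟨x, rfl⟩ := hf a
    obtain ⟨y, rfl⟩ := hf b
    change g (Function.surjInv hf (f x + f y))
      = g (Function.surjInv hf (f x)) + g (Function.surjInv hf (f y))
    rw [← map_add, hk, hk, hk, map_add]

theorem exists_ringEquiv {α β γ : Type*} [Semiring α] [Semiring β] [Semiring γ] {f : α →+* β}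
    (hf : Function.Surjective f) {g : α →+* γ} (hg : Function.Surjective g)
    (h : ∀ x y, f x = f y ↔ g x = g y) : ∃ e : β ≃+* γ, ∀ x, e (f x) = g x := by
  obtain ⟨k, hk⟩ := exists_comp_eq hf g fun x y => (h x y).1
  obtain ⟨l, hl⟩ := exists_comp_eq hg f fun x y => (h x y).2
  have hk' : ∀ x, k (f x) = g x := RingHom.congr_fun hk
  have hl' : ∀ x, l (g x) = f x := RingHom.congr_fun hl
  refine ⟨RingEquiv.ofRingHom k l (RingHom.ext fun c => ?_) (RingHom.ext fun b => ?_), hk'⟩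
  · obtain ⟨x, rfl⟩ := hg c
    simp [hk', hl']
  · obtain ⟨x, rfl⟩ := hf b
    simp [hk', hl']

end Lift

/-! ### The order on functions as integral dependence -/

section Kernel

variable {V N : Type*} [NormedAddCommGroup V] [NormedSpace ℝ V] [MetricSpace N]
  [NormedAddTorsor V N] {Λ : Submodule ℤ V} {Δ : RatPolytope N Λ}

theorem FracIdeal.principal_le_iff {M : Type*} [AddCommMonoid M] {P : AddSubmonoid M} {x : M}
    {I : FracIdeal P} : FracIdeal.principal P x ≤ I ↔ x ∈ I.carrier := by
  refine ⟨fun h => h (FracIdeal.mem_principal.2 ⟨0, P.zero_mem, add_zero x⟩), fun h y hy => ?_⟩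
  obtain ⟨p, hp, rfl⟩ := FracIdeal.mem_principal.1 hy
  exact I.add_mem x h p hp

theorem FracIdeal.principal_pow {M : Type*} [AddCommMonoid M] {P : AddSubmonoid M} (x : M)
    (n : ℕ) : FracIdeal.principal P x ^ n = FracIdeal.principal P (n • x) := by
  induction n with
  | zero => rw [pow_zero, zero_nsmul, FracIdeal.principal_zero]
  | succ n ih => rw [pow_succ, ih, FracIdeal.principal_mul_principal, succ_nsmul]

theorem FracIdeal.principal_sum {M J : Type*} [AddCommMonoid M] {P : AddSubmonoid M}
    (s : Finset J) (x : J → M) :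
    FracIdeal.principal P (∑ j ∈ s, x j) = ∏ j ∈ s, FracIdeal.principal P (x j) := by
  classical
  induction s using Finset.induction_on with
  | empty => rw [Finset.sum_empty, Finset.prod_empty, FracIdeal.principal_zero]
  | insert a s ha ih =>
    rw [Finset.sum_insert ha, Finset.prod_insert ha, ← FracIdeal.principal_mul_principal, ih]

/-- Every element of `B[Q; Q⁺]` other than `-∞` is bounded. -/
theorem bounded_of_nonempty [FiniteDimensional ℝ V] {I : Δ.B} (h : I.carrier.Nonempty) :
    Bounded I := by
  obtain ⟨F, hF⟩ := h
  obtain ⟨u, hu⟩ := Tate.exists_le_unit I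
  exact ⟨principalUnit F, u, FracIdeal.principal_le_iff.2 hF, hu⟩

/-- A function in `Q` lying below `ev Y` is integral over `Y`. -/
theorem exists_bounded_principal_mul_le [FiniteDimensional ℝ V] [DiscreteTopology Λ]
    [IsZLattice ℝ Λ] {Y : Δ.B} (hY : Y.carrier.Nonempty) (F : intAffine N Λ)
    (hF : ∀ x : Δ.carrier, (F : N →ᵃ[ℝ] ℝ) x ≤ evFun Y x) :
    ∃ S : Δ.B, Bounded S ∧ FracIdeal.principal Δ.nonpos F * S ≤ Y * S := by
  rcases Set.eq_empty_or_nonempty Δ.carrier with hΔ | hΔ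
  · refine ⟨1, Bounded.one, mul_le_mul_left (FracIdeal.principal_le_iff.2 ?_) 1⟩
    obtain ⟨G, hG⟩ := hY
    -- On the empty polytope all functions are nonpositive.
    have := Y.add_mem G hG (F - G) fun x hx => by simp [hΔ] at hx
    rwa [add_sub_cancel] at this
  obtain ⟨G, hGfin, hYG⟩ := Y.fg
  have : Fintype G := hGfin.fintype
  have hGY : ∀ g : G, FracIdeal.principal Δ.nonpos (g : intAffine N Λ) ≤ Y := fun g =>
    FracIdeal.principal_le_iff.2
      (hYG ▸ ⟨g, g.2, 0, Δ.nonpos.zero_mem, add_zero (g : intAffine N Λ)⟩)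
  obtain ⟨n, hn, hnF⟩ := exists_nsmul_le_sum_nsmul hΔ F (fun g : G => (g : intAffine N Λ))
    fun x hx => by
      obtain ⟨g, hg, -, -, he⟩ := exists_generator_isGreatest hGfin hYG hY ⟨x, hx⟩
      exact ⟨⟨g, hg⟩, (hF ⟨x, hx⟩).trans he.le⟩
  have hpow : FracIdeal.principal Δ.nonpos F ^ (∑ g, n g) ≤ Y ^ (∑ g, n g) := by
    rw [FracIdeal.principal_pow]
    refine FracIdeal.principal_le_iff.2 ?_
    have h₁ : FracIdeal.principal Δ.nonpos (∑ g : G, n g • (g : intAffine N Λ))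
        ≤ Y ^ (∑ g, n g) := by
      rw [FracIdeal.principal_sum, ← Finset.prod_pow_eq_pow_sum]
      refine Finset.prod_le_prod' fun g _ => ?_
      rw [← FracIdeal.principal_pow]
      exact pow_le_pow_left' (hGY g) _
    have h₂ := (Y ^ (∑ g, n g)).add_mem _ (FracIdeal.principal_le_iff.1 h₁) _ hnF
    rwa [add_sub_cancel] at h₂
  obtain ⟨m, hm⟩ := Nat.exists_eq_succ_of_ne_zero hn.ne'
  rw [hm] at hpow
  exact ⟨_, (bounded_of_nonempty (hY.mono Set.subset_union_right)).pow m,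
    mul_add_pow_le_of_pow_le hpow⟩

theorem CPA.ofFun_ne_zero (f : CPAFun Δ) : CPA.ofFun f ≠ 0 := WithBot.coe_ne_bot

theorem CPA.eq_zero_or_ofFun (a : CPA Δ) : a = 0 ∨ ∃ f, a = CPA.ofFun f := by
  induction a using WithBot.recBotCoe with
  | bot => exact Or.inl rfl
  | coe f => exact Or.inr ⟨f, rfl⟩

theorem CPA.zero_le (a : CPA Δ) : 0 ≤ a := bot_le (α := WithBot (CPAFun Δ))

theorem CPA.le_zero {a : CPA Δ} (h : a ≤ 0) : a = 0 := le_bot_iff (α := WithBot (CPAFun Δ)).1 h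

/-- Bounded elements of `CPA_ℤ(Δ, ℝ)` are real-valued functions, hence cancellable. -/
theorem CPA.le_of_mul_le_mul {a b s : CPA Δ} (hs : Bounded s) (h : a * s ≤ b * s) : a ≤ b := by
  rcases CPA.eq_zero_or_ofFun s with rfl | ⟨s, rfl⟩
  · obtain ⟨u, -, hu, -⟩ := hs
    have h₁ := u.mul_inv
    rw [CPA.le_zero hu, zero_mul, CPA.one_eq] at h₁
    exact absurd h₁.symm (CPA.ofFun_ne_zero 0)
  rcases CPA.eq_zero_or_ofFun a with rfl | ⟨a, rfl⟩
  · exact CPA.zero_le b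
  rcases CPA.eq_zero_or_ofFun b with rfl | ⟨b, rfl⟩
  · rw [zero_mul, CPA.ofFun_mul] at h
    exact absurd (CPA.le_zero h) (CPA.ofFun_ne_zero _)
  rw [CPA.ofFun_mul, CPA.ofFun_mul, CPA.ofFun_le] at h
  exact CPA.ofFun_le.2 fun x => le_of_add_le_add_right (h x)

theorem ev_of_nonempty {I : Δ.B} (h : I.carrier.Nonempty) : ev Δ I = CPA.ofFun (evCPAFun I h) :=
  evMap_of_nonempty h

theorem ev_le_of_mul_le_mul {X Y S : Δ.B} (hS : Bounded S) (h : X * S ≤ Y * S) :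
    ev Δ X ≤ ev Δ Y := by
  refine CPA.le_of_mul_le_mul (hS.map (ev Δ)) ?_
  rw [← map_mul, ← map_mul]
  exact ringHom_monotone _ h

/-- Inequalities between functions on `Δ` are integral dependences in `B[Q; Q⁺]`; with
`ev_le_of_mul_le_mul` this identifies the order pulled back along `ev`. -/
theorem exists_bounded_mul_le_of_ev_le [FiniteDimensional ℝ V] [DiscreteTopology Λ]
    [IsZLattice ℝ Λ] {X Y : Δ.B} (h : ev Δ X ≤ ev Δ Y) :
    ∃ S : Δ.B, Bounded S ∧ X * S ≤ Y * S := by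
  rcases eq_zero_or_nonempty X with rfl | hX
  · exact ⟨1, Bounded.one, mul_le_mul_left (FracIdeal.le_def.2 (Set.empty_subset _)) 1⟩
  rcases eq_zero_or_nonempty Y with rfl | hY
  · rw [map_zero, ev_of_nonempty hX] at h
    exact absurd (CPA.le_zero h) (CPA.ofFun_ne_zero _)
  rw [ev_of_nonempty hX, ev_of_nonempty hY, CPA.ofFun_le] at h
  -- The multipliers for the members of a finite generating set are multiplied together.
  have key : ∀ G : Set (intAffine N Λ), G.Finite → G ⊆ X.carrier → ∃ S : Δ.B, Bounded S ∧
      ∀ F ∈ G, FracIdeal.principal Δ.nonpos F * S ≤ Y * S := fun G hG => by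
    induction G, hG using Set.Finite.induction_on with
    | empty => exact fun _ => ⟨1, Bounded.one, by simp⟩
    | @insert F G _ _ ih =>
      intro hsub
      obtain ⟨S, hS, hle⟩ := ih ((Set.subset_insert F G).trans hsub)
      obtain ⟨T, hT, hleT⟩ := exists_bounded_principal_mul_le hY F fun x =>
        ((isGreatest_evFun hX x).2 ⟨F, hsub (Set.mem_insert F G), rfl⟩).trans (h x)
      refine ⟨S * T, hS.mul hT, fun F' hF' => ?_⟩
      rcases hF' with rfl | hF'
      · rw [mul_left_comm, mul_left_comm Y]
        exact mul_le_mul_right hleT S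
      · rw [← mul_assoc, ← mul_assoc]
        exact mul_le_mul_left (hle F' hF') T
  obtain ⟨G, hG, hXG⟩ := X.fg
  obtain ⟨S, hS, hle⟩ := key G hG fun g hg =>
    hXG ▸ ⟨g, hg, 0, Δ.nonpos.zero_mem, add_zero g⟩
  refine ⟨S, hS, ?_⟩
  rw [FracIdeal.le_def, FracIdeal.carrier_mul_eq, hXG]
  rintro _ ⟨_, ⟨g, hg, q, hq, rfl⟩, s, hs, rfl⟩
  exact hle g hg ⟨g + q, FracIdeal.mem_principal.2 ⟨q, hq, rfl⟩, s, hs, rfl⟩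

theorem algebraMap_PL_eq_iff [FiniteDimensional ℝ V] [DiscreteTopology Λ] [IsZLattice ℝ Λ]
    (X Y : Δ.B) : algebraMap Δ.B (PL Δ.B) X = algebraMap Δ.B (PL Δ.B) Y ↔ ev Δ X = ev Δ Y := by
  rw [IsLocalization.eq_iff_exists (boundedSubmonoid Δ.B)]
  constructor
  · rintro ⟨⟨S, hS⟩, h⟩
    have h' : X * S = Y * S := by rw [mul_comm X, mul_comm Y]; exact h
    exact le_antisymm (ev_le_of_mul_le_mul hS h'.le) (ev_le_of_mul_le_mul hS h'.ge)
  · intro h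
    obtain ⟨S, hS, hle⟩ := exists_bounded_mul_le_of_ev_le h.le
    obtain ⟨T, hT, hge⟩ := exists_bounded_mul_le_of_ev_le h.ge
    refine ⟨⟨S * T, hS.mul hT⟩, ?_⟩
    change S * T * X = S * T * Y
    refine le_antisymm ?_ ?_
    · rw [mul_comm _ X, mul_comm _ Y, ← mul_assoc, ← mul_assoc]
      exact mul_le_mul_left hle T
    · rw [mul_comm _ X, mul_comm _ Y, mul_left_comm X, mul_left_comm Y]
      exact mul_le_mul_right hge S

end Kernel

/-! ### Convex piecewise affine functions are maxima of affine functions -/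

section Surjective

variable {V N : Type*} [NormedAddCommGroup V] [NormedSpace ℝ V] [MetricSpace N]
  [NormedAddTorsor V N] {Λ : Submodule ℤ V} {Δ : RatPolytope N Λ}

theorem affine_lineMap (F : N →ᵃ[ℝ] ℝ) (x y : N) (t : ℝ) :
    F (AffineMap.lineMap x y t) = (1 - t) * F x + t * F y := by
  rw [AffineMap.apply_lineMap, AffineMap.lineMap_apply]
  simp only [vsub_eq_sub, smul_eq_mul, vadd_eq_add]
  ring

theorem RatPolytope.lineMap_mem (Δ : RatPolytope N Λ) {x y : N} (hx : x ∈ Δ.carrier)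
    (hy : y ∈ Δ.carrier) {t : ℝ} (h0 : 0 ≤ t) (h1 : t ≤ 1) :
    AffineMap.lineMap x y t ∈ Δ.carrier := by
  obtain ⟨s, -, -, hs⟩ := Δ.cut_out
  rw [hs] at hx hy ⊢
  intro F hF
  rw [affine_lineMap]
  exact add_nonpos (mul_nonpos_of_nonneg_of_nonpos (by linarith) (hx F hF))
    (mul_nonpos_of_nonneg_of_nonpos h0 (hy F hF))

theorem IsPolyhedron.isClosed [FiniteDimensional ℝ V] {A : Set N} (hA : IsPolyhedron A) :
    IsClosed A := by
  obtain ⟨s, -, rfl⟩ := hA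
  simp only [Set.ofPred_forall]
  exact isClosed_biInter fun F _ =>
    isClosed_le F.continuous_of_finiteDimensional continuous_const

/-- Through every point of the graph of a convex function agreeing with finitely many affine
functions on closed pieces passes one of these affine functions lying below the given function.
Near the given point `x` a point `x'` is chosen that lies in as few pieces as possible; all points
of `Δ` near `x'` then lie in the same pieces as `x'`, so the function is affine near `x'`, and by
convexity it lies above its affine germ. -/
theorem exists_affine_le [FiniteDimensional ℝ V] {f : Δ.carrier → ℝ} (hf : IsConvexFun Δ f)
    {C : Set (Set N × intAffine N Λ)} (hC : C.Finite) (hpoly : ∀ p ∈ C, IsPolyhedron p.1)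
    (hcov : ∀ x : Δ.carrier, ∃ p ∈ C, (x : N) ∈ p.1)
    (heq : ∀ p ∈ C, ∀ x : Δ.carrier, (x : N) ∈ p.1 → f x = (p.2 : N →ᵃ[ℝ] ℝ) x)
    (x : Δ.carrier) :
    ∃ p ∈ C, (x : N) ∈ p.1 ∧ ∀ y : Δ.carrier, (p.2 : N →ᵃ[ℝ] ℝ) y ≤ f y := by
  let T : N → Set (Set N × intAffine N Λ) := fun z => {p ∈ C | z ∈ p.1}
  have hTfin : ∀ z, (T z).Finite := fun z => hC.subset (Set.sep_subset _ _)
  have hT : ∀ z, ∀ᶠ z' in nhds z, T z' ⊆ T z := fun z => by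
    have h₁ : ∀ᶠ z' in nhds z, ∀ p ∈ C, z ∉ p.1 → z' ∉ p.1 := by
      rw [Filter.eventually_all_finite hC]
      intro p hp
      by_cases hz : z ∈ p.1
      · exact Filter.Eventually.of_forall fun _ h => absurd hz h
      · filter_upwards [(hpoly p hp).isClosed.isOpen_compl.mem_nhds hz] with z' hz' _
        exact hz'
    filter_upwards [h₁] with z' hz' p hp
    exact ⟨hp.1, by_contra fun h => hz' p hp.1 h hp.2⟩
  obtain ⟨O, hO, hOopen, hxO⟩ := eventually_nhds_iff.1 (hT x)
  obtain ⟨x', hx'O, hmin⟩ := (measure fun z : N => (T z).ncard).wf.has_min (Δ.carrier ∩ O)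
    ⟨x, x.2, hxO⟩
  obtain ⟨p, hpC, hp⟩ := hcov ⟨x', hx'O.1⟩
  refine ⟨p, hpC, (hO x' hx'O.2 ⟨hpC, hp⟩).2, fun y => ?_⟩
  have hnear : ∀ᶠ z in nhds x', z ∈ Δ.carrier → z ∈ p.1 := by
    filter_upwards [hT x', hOopen.mem_nhds hx'O.2] with z hz hzO hzΔ
    have h₁ : ¬ (T z).ncard < (T x').ncard := hmin z ⟨hzΔ, hzO⟩
    have h₂ : T z = T x' := Set.eq_of_subset_of_ncard_le hz (not_lt.1 h₁) (hTfin x')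
    have h₃ : p ∈ T z := h₂ ▸ (⟨hpC, hp⟩ : p ∈ T x')
    exact h₃.2
  have hcont : Continuous fun t : ℝ => AffineMap.lineMap x' (y : N) t :=
    AffineMap.lineMap_continuous
  have hev : ∀ᶠ t in nhdsWithin (0 : ℝ) (Set.Ioi 0),
      AffineMap.lineMap x' (y : N) t ∈ Δ.carrier → AffineMap.lineMap x' (y : N) t ∈ p.1 := by
    have h₁ := hcont.tendsto 0
    rw [AffineMap.lineMap_apply_zero] at h₁
    exact (h₁.eventually hnear).filter_mono nhdsWithin_le_nhds
  obtain ⟨t, ht, ht0, ht1⟩ := (hev.and (Ioc_mem_nhdsGT (zero_lt_one' ℝ))).exists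
  have hmem := Δ.lineMap_mem hx'O.1 y.2 ht0.le ht1
  have h₁ := hf ⟨x', hx'O.1⟩ y ⟨_, hmem⟩ t ht0.le ht1 rfl
  rw [heq p hpC ⟨_, hmem⟩ (ht hmem), heq p hpC ⟨x', hx'O.1⟩ hp] at h₁
  simp only [affine_lineMap] at h₁
  exact le_of_mul_le_mul_left (by linarith) ht0

theorem ev_surjective [FiniteDimensional ℝ V] (Δ : RatPolytope N Λ) :
    Function.Surjective (ev Δ) := by
  intro a
  rcases CPA.eq_zero_or_ofFun a with rfl | ⟨f, rfl⟩
  · exact ⟨0, map_zero _⟩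
  rcases isEmpty_or_nonempty Δ.carrier with hΔ | ⟨⟨x₀⟩⟩
  · refine ⟨1, ?_⟩
    rw [map_one, CPA.one_eq]
    exact congrArg _ (Subtype.ext (funext fun x => isEmptyElim x))
  obtain ⟨C, hC, hpoly, hcov, heq⟩ := f.2.2
  have hex := exists_affine_le f.2.1 hC hpoly hcov heq
  let G : Set (intAffine N Λ) :=
    Prod.snd '' {p ∈ C | ∀ y : Δ.carrier, (p.2 : N →ᵃ[ℝ] ℝ) y ≤ f.1 y}
  have hG : G.Finite := (hC.subset (Set.sep_subset _ _)).image _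
  let I : Δ.B := FracIdeal.span Δ.nonpos G hG
  have hGI : ∀ g ∈ G, g ∈ I.carrier := fun g hg => ⟨g, hg, 0, Δ.nonpos.zero_mem, add_zero g⟩
  have hI : I.carrier.Nonempty := by
    obtain ⟨p, hpC, -, hp⟩ := hex x₀
    exact ⟨p.2, hGI _ ⟨p, ⟨hpC, hp⟩, rfl⟩⟩
  refine ⟨I, ?_⟩
  rw [ev_of_nonempty hI]
  refine congrArg _ (Subtype.ext (funext fun x => (isGreatest_evFun hI x).unique ⟨?_, ?_⟩))
  · obtain ⟨p, hpC, hxp, hp⟩ := hex x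
    exact ⟨p.2, hGI _ ⟨p, ⟨hpC, hp⟩, rfl⟩, (heq p hpC x hxp).symm⟩
  · rintro _ ⟨_, ⟨_, ⟨p, ⟨-, hp⟩, rfl⟩, q, hq, rfl⟩, rfl⟩
    exact (add_le_add (hp x) (hq x x.2)).trans (add_zero _).le

end Surjective

/-! ### Integral closures of principal ideals -/

section Closure

variable {V N : Type*} [NormedAddCommGroup V] [NormedSpace ℝ V] [MetricSpace N]
  [NormedAddTorsor V N] {Λ : Submodule ℤ V} {Δ : RatPolytope N Λ}

/-- The order ideal of all `Y` with `ev Y ≤ ev X`. -/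
def evIdeal (X : Δ.B) : Order.Ideal Δ.B where
  carrier := {Y | ev Δ Y ≤ ev Δ X}
  lower' _ _ hle hY := le_trans (ringHom_monotone (ev Δ) hle) hY
  nonempty' := ⟨X, le_refl (ev Δ X)⟩
  directed' Y hY Z hZ := by
    refine ⟨Y + Z, ?_, (add_eq_sup Y Z).symm ▸ le_sup_left, (add_eq_sup Y Z).symm ▸ le_sup_right⟩
    change ev Δ (Y + Z) ≤ ev Δ X
    rw [map_add]
    exact add_le hY hZ

theorem mem_evIdeal {X Y : Δ.B} : Y ∈ evIdeal X ↔ ev Δ Y ≤ ev Δ X := Iff.rfl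

theorem isIntegralOver_evIdeal [FiniteDimensional ℝ V] [DiscreteTopology Λ] [IsZLattice ℝ Λ]
    (X : Δ.B) : IsIntegralOver (evIdeal X) (Order.Ideal.principal X) := by
  refine ⟨Order.Ideal.principal_le_iff.2 (mem_evIdeal.2 le_rfl), fun Y hY => ?_⟩
  obtain ⟨S, hS, h⟩ := exists_bounded_mul_le_of_ev_le hY
  exact ⟨S, hS, X, Order.Ideal.mem_principal_self, h⟩

theorem isIntegrallyClosed_evIdeal (X : Δ.B) : IsIntegrallyClosed (evIdeal X) := by
  rintro κ ⟨-, hκ⟩ Z hZ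
  obtain ⟨S, hS, Y, hY, hle⟩ := hκ Z hZ
  exact (ev_le_of_mul_le_mul hS hle).trans (mem_evIdeal.1 hY)

theorem isIntegrallyClosedElement_iff [FiniteDimensional ℝ V] [DiscreteTopology Λ]
    [IsZLattice ℝ Λ] (X : Δ.B) :
    IsIntegrallyClosedElement X ↔ IsGreatest {Y | ev Δ Y = ev Δ X} X := by
  constructor
  · exact fun h => ⟨rfl, fun Y hY => Order.Ideal.mem_principal.1
      (h _ (isIntegralOver_evIdeal X) (mem_evIdeal.2 hY.le))⟩
  · rintro ⟨-, h⟩ κ ⟨-, hκ⟩ Z hZ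
    obtain ⟨S, hS, Y, hY, hle⟩ := hκ Z hZ
    have h₁ : ev Δ Z ≤ ev Δ X := (ev_le_of_mul_le_mul hS hle).trans
      (ringHom_monotone _ (Order.Ideal.mem_principal.1 hY))
    have h₂ : X + Z ≤ X := h (show ev Δ (X + Z) = ev Δ X by
      rw [map_add, add_eq_left_iff_le.2 h₁])
    exact Order.Ideal.mem_principal.2 (add_le_iff.1 h₂).2

end Closure

/-! ### The normalisation -/

theorem isNormalisation_ev {V : Type u} {N : Type v} [NormedAddCommGroup V] [NormedSpace ℝ V]
    [FiniteDimensional ℝ V] [MetricSpace N] [NormedAddTorsor V N]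
    (Λ : Submodule ℤ V) [DiscreteTopology Λ] [IsZLattice ℝ Λ] (Δ : RatPolytope N Λ) :
    IsNormalisation.{max u v, v, w} (ev Δ) where
  isNormal := isNormal_of_cancel fun _ _ _ => CPA.le_of_mul_le_mul
  initial γ _ _ hγ g := by
    have hle : ∀ X Y, ev Δ X ≤ ev Δ Y → g X ≤ g Y := fun X Y h => by
      obtain ⟨S, hS, hXY⟩ := exists_bounded_mul_le_of_ev_le h
      refine hγ.le_of_mul_le_mul (hS.map g) ?_
      rw [← map_mul, ← map_mul]
      exact ringHom_monotone g hXY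
    obtain ⟨k, hk⟩ := exists_comp_eq (ev_surjective Δ) g fun X Y h =>
      le_antisymm (hle X Y h.le) (hle Y X h.ge)
    refine ⟨k, hk, fun k' hk' => RingHom.ext fun a => ?_⟩
    obtain ⟨X, rfl⟩ := ev_surjective Δ a
    exact (RingHom.congr_fun hk' X).trans (RingHom.congr_fun hk X).symm
  equiv_imagePL := exists_ringEquiv (RingHom.rangeSRestrict_surjective _) (ev_surjective Δ)
    fun X Y => Subtype.ext_iff.trans (algebraMap_PL_eq_iff X Y)

end IdempotentSemiring

open IdempotentSemiring in
theorem theorem5 {V : Type u} {N : Type v} [NormedAddCommGroup V] [NormedSpace ℝ V]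
    [FiniteDimensional ℝ V] [MetricSpace N] [NormedAddTorsor V N]
    (Λ : Submodule ℤ V) [DiscreteTopology Λ] [IsZLattice ℝ Λ] (Δ : RatPolytope N Λ) :
    IsNormalisation.{max u v, v, w} (ev Δ) ∧
    (∀ X : Δ.B, ∃ κ : Order.Ideal Δ.B, IsIntegralClosure κ (Order.Ideal.principal X) ∧
      (κ : Set Δ.B) = {Y | ev Δ Y ≤ ev Δ X}) ∧
    (∀ X : Δ.B, IsIntegrallyClosedElement X ↔ IsGreatest {Y | ev Δ Y = ev Δ X} X) :=
  ⟨isNormalisation_ev Λ Δ,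
    fun X => ⟨evIdeal X, ⟨isIntegrallyClosed_evIdeal X, isIntegralOver_evIdeal X⟩, rfl⟩,
    isIntegrallyClosedElement_iff⟩
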